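/- **Theorem.** Let $F$ be any field. Fix the following sets. * $F^\square\subseteq F^*$, a transversal of the subgroup of squares $(F^*)^2$ in $F^*$. * For each $\rho\in F^\square$, a set $A_\rho(F)$ of representatives for the classes of the following equivalence relation on $(F\setminus\{1\})\times F$: $(\beta_1,\beta_2)$ is related to $(\beta_3,\beta_4)$ if and only if either $(\beta_3,\beta_4)=(\beta_1,\pm\beta_2)$, or, for some $t\in F$ with $(t^2+\rho)(t^2+\beta_2t-\rho\beta_1)\ne0$, $$\beta_3=\frac{\beta_1t^2+\beta_2t-\rho}{t^2+\beta_2t-\rho\beta_1},\qquad \beta_4=\pm\frac{\beta_2t^2-2\rho(\beta_1+1)t-\rho\beta_2}{t^2+\beta_2t-\rho\beta_1}.$$ * If $\operatorname{char}F=2$: a transversal $B(F)$ of the additive subgroup $\{\lambda^2+\lambda:\lambda\in F\}$ in $F$, and a set $C(F)\subseteq F^\square$ of representatives for the classes of the following equivalence relation on $F^\square$: $\rho_1$ is related to $\rho_2$ if and only if $\rho_2=\frac{x_1^2+x_2^2\rho_1}{x_3^2+x_4^2\rho_1}$ for some $x_1,x_2,x_3,x_4\in F$ with $x_1x_4\neq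 x_2x_3$ and $x_3^2+x_4^2\rho_1\ne0$. * Sets $\Pi_S(F)$ and $\Pi_A(F)$ of representatives of the projective congruence classes of, respectively, symmetric and asymmetric (that is, not symmetric) matrices in $\mathrm{Mat}_3(F)$. Here $D,E$ are projectively congruent if $PDP^{T}=\lambda E$ for some $P\in GL_3(F)$ and $\lambda\in F^*$. For each line below, consider the set of all $5\times5$ matrices over $F$ with first row $(0,x_1,x_2,x_3,x_4)$, first column and last row zero, and rows $2,3,4$, restricted to columns $2,\dots,5$, as displayed, where $x_1,\dots,x_4$ run over $F$. Each of these sets is an algebra under matrix addition, multiplication and scaling. Table 1 (commutative): * $S_{(5)}$: $(0,x_1,x_2,x_3)$, $(0,0,x_1,x_2)$, $(0,0,0,x_1)$; * $S_{(4,1)}$: $(0,x_1,x_2,0)$, $(0,0,x_1,0)$, $(0,0,0,0)$; * $S_{(3,2)}^\sharp$: $(0,x_1,0,x_2)$, $(0,0,0,x_1)$, $(0,0,0,x_3)$; * $U_1(0,0)$, if $\operatorname{char}F\ne2$: $(0,0,x_1,x_2)$, $(0,0,0,x_1)$, $(0,0,0,0)$; * $U_1(0,\rho)$, with $\rho\in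 F^\square$ if $\operatorname{char}F\neq2$ and $\rho\in C(F)$ if $\operatorname{char}F=2$: $(0,0,x_1,x_2)$, $(0,0,\rho x_2,x_1)$, $(0,0,0,0)$; * $U_1(1,\epsilon)$, if $\operatorname{char}F=2$, with $\epsilon\in B(F)$: $(0,0,x_1,x_2)$, $(0,0,\epsilon x_2,x_1+x_2)$, $(0,0,0,0)$; * $R_D$ with $D\in\Pi_S(F)$: $(0,0,0,y_1)$, $(0,0,0,y_2)$, $(0,0,0,y_3)$, where $(y_1,y_2,y_3)^T=D(x_1,x_2,x_3)^T$. Table 2 (noncommutative): * $U_2(0,1,0,1,1)$: $(0,x_1,0,x_2+x_3)$, $(0,0,0,x_1)$, $(0,0,0,x_3)$; * $U_2(0,1,0,0,1)$: $(0,x_1,0,x_2+x_3)$, $(0,0,0,x_1)$, $(0,0,0,0)$; * $U_3(0,1,0)$: $(0,x_1,0,0)$, $(0,0,0,0)$, $(0,0,0,x_1)$; * $U_3(0,1,1)$: $(0,x_1,0,0)$, $(0,0,0,0)$, $(0,0,0,x_1+x_3)$; * $U_3(1,\lambda,0)$ with $\lambda\in F\setminus\{1\}$: $(0,x_1,0,x_3)$,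 $(0,0,0,0)$, $(0,0,0,\lambda x_1)$; * $U_4(\rho,\beta_1,\beta_2)$ with $\rho\in F^\square$ and $(\beta_1,\beta_2)\in A_\rho(F)$: $(0,0,x_1,x_2)$, $(0,0,\rho x_2,\beta_1x_1+\beta_2x_2)$, $(0,0,0,0)$; * $U_5(1,1,\epsilon)$, if $\operatorname{char}F=2$, with $\epsilon\in B(F)$: $(0,0,x_2,x_1+x_2)$, $(0,0,x_1,\epsilon x_2)$, $(0,0,0,0)$; * $R_D$ with $D\in\Pi_A(F)$: as in Table 1. Then the algebras of Table 1 are commutative and those of Table 2 are noncommutative, and all of them are 4-dimensional nilpotent associative $F$-algebras. Every 4-dimensional nilpotent associative $F$-algebra is isomorphic to an algebra of Table 1 if it is commutative, and of Table 2 if it is not. Algebras that belong to different lines of the tables, or to the same line with different parameters, are not isomorphic. -/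

import Mathlib

namespace NilpAlg

section Algebras

/-- `npow F N k` is the power `N ^ (k + 1)` of the (non-unital, associative) algebra `N`: the
linear span of all products of `k + 1` elements, built by `N ^ 1 = N` and
`N ^ (k + 2) = N ^ (k + 1) * N`. -/
def npow (F N : Type*) [Field F] [NonUnitalRing N] [Module F N] : ℕ → Submodule F N
  | 0 => ⊤
  | k + 1 => Submodule.span F {z : N | ∃ x ∈ npow F N k, ∃ y : N, z = x * y}

/-- `N` is a nilpotent algebra: some power of `N` is zero. -/
def IsNilpotentAlgebra (F N : Type*) [Field F] [NonUnitalRing N] [Module F N] : Prop :=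
  ∃ k : ℕ, npow F N k = ⊥

/-- Isomorphism of (not necessarily unital) associative `F`-algebras. -/
def AlgIso (F N M : Type*) [Field F] [NonUnitalRing N] [Module F N]
    [NonUnitalRing M] [Module F M] : Prop :=
  ∃ f : N →ₙₐ[F] M, Function.Bijective f

end Algebras

section Parameters

/-- `S` is a set of representatives, inside `X`, of the classes of the relation `r` on `X`: every
element of `X` is related to exactly one element of `S`. -/
def IsRepSet {α : Type*} (r : α → α → Prop) (X S : Set α) : Prop :=
  S ⊆ X ∧ ∀ x ∈ X, ∃! s, s ∈ S ∧ r x s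

/-- Equality modulo the squares of the multiplicative group of `F` (for nonzero elements). -/
def SqClass (F : Type*) [Field F] (a b : F) : Prop := ∃ c : F, c ≠ 0 ∧ a = c ^ 2 * b

/-- `Q` is a transversal of the nonzero squares in the multiplicative group of `F`. -/
def IsSquareTransversal {F : Type*} [Field F] (Q : Set F) : Prop :=
  IsRepSet (SqClass F) {a : F | a ≠ 0} Q

/-- Equality modulo the elements of the form `l ^ 2 + l`. -/
def ArtinSchreierClass (F : Type*) [Field F] (a b : F) : Prop := ∃ l : F, a - b = l ^ 2 + l

/-- `B` is a transversal in `F` of the additive subgroup `{l ^ 2 + l}` (used in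
characteristic two). -/
def IsBSet {F : Type*} [Field F] (B : Set F) : Prop :=
  IsRepSet (ArtinSchreierClass F) Set.univ B

/-- The relation `⋆`, used on a transversal of the squares in characteristic two. -/
def StarRel (F : Type*) [Field F] (r s : F) : Prop :=
  ∃ x₁ x₂ x₃ x₄ : F, x₁ * x₄ ≠ x₂ * x₃ ∧ x₃ ^ 2 + x₄ ^ 2 * r ≠ 0 ∧
    s = (x₁ ^ 2 + x₂ ^ 2 * r) / (x₃ ^ 2 + x₄ ^ 2 * r)

/-- `C` is a set of representatives in `Q` for `⋆`. -/
def IsCSet {F : Type*} [Field F] (Q C : Set F) : Prop :=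
  IsRepSet (StarRel F) Q C

/-- The relation on `(F \ {1}) × F` attached to `r ≠ 0`. The two signs are the two values
of `e`. -/
def ARel {F : Type*} [Field F] (r : F) (b c : F × F) : Prop :=
  (∃ e : F, (e = 1 ∨ e = -1) ∧ c = (b.1, e * b.2)) ∨
  ∃ t e : F, (e = 1 ∨ e = -1) ∧ (t ^ 2 + r) * (t ^ 2 + b.2 * t - r * b.1) ≠ 0 ∧
    c.1 = (b.1 * t ^ 2 + b.2 * t - r) / (t ^ 2 + b.2 * t - r * b.1) ∧
    c.2 = e * ((b.2 * t ^ 2 - 2 * r * (b.1 + 1) * t - r * b.2) / (t ^ 2 + b.2 * t - r * b.1))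

/-- `A` is a set of representatives for `ARel r` on `(F \ {1}) × F`. -/
def IsASet {F : Type*} [Field F] (r : F) (A : Set (F × F)) : Prop :=
  IsRepSet (ARel r) {b : F × F | b.1 ≠ 1} A

/-- Projective congruence of square matrices: `P * D * Pᵀ = l • E` with `P` invertible and
`l ≠ 0`. -/
def ProjCongruent {F : Type*} [Field F] (D E : Matrix (Fin 3) (Fin 3) F) : Prop :=
  ∃ (P : Matrix (Fin 3) (Fin 3) F) (l : F), IsUnit P ∧ l ≠ 0 ∧ P * D * P.transpose = l • E

/-- Representatives of the projective congruence classes of symmetric `3 × 3` matrices. -/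
def IsPiS {F : Type*} [Field F] (S : Set (Matrix (Fin 3) (Fin 3) F)) : Prop :=
  IsRepSet ProjCongruent {D | D.transpose = D} S

/-- Representatives of the projective congruence classes of asymmetric (that is, not symmetric)
`3 × 3` matrices. -/
def IsPiA {F : Type*} [Field F] (S : Set (Matrix (Fin 3) (Fin 3) F)) : Prop :=
  IsRepSet ProjCongruent {D | D.transpose ≠ D} S

end Parameters

section Tables

/-- The lines of the commutative table, with their parameters (not yet restricted). -/
inductive CommRow (F : Type*) : Type _
  | S5
  | S41
  | S32sharp
  | U1_00
  | U1_0 (ρ : F)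
  | U1_1 (ε : F)
  | RD (D : Matrix (Fin 3) (Fin 3) F)

/-- The lines of the noncommutative table, with their parameters (not yet restricted). -/
inductive NoncommRow (F : Type*) : Type _
  | U2_01011
  | U2_01001
  | U3_010
  | U3_011
  | U3_1 (l : F)
  | U4 (ρ β₁ β₂ : F)
  | U5_11 (ε : F)
  | RD (D : Matrix (Fin 3) (Fin 3) F)

variable {F : Type*} [Field F]

/-- The matrices attached to a bilinear form `D` in three variables. -/
def matRD (D : Matrix (Fin 3) (Fin 3) F) (x₁ x₂ x₃ x₄ : F) : Matrix (Fin 5) (Fin 5) F :=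
  !![0, x₁, x₂, x₃, x₄;
     0, 0, 0, 0, D 0 0 * x₁ + D 0 1 * x₂ + D 0 2 * x₃;
     0, 0, 0, 0, D 1 0 * x₁ + D 1 1 * x₂ + D 1 2 * x₃;
     0, 0, 0, 0, D 2 0 * x₁ + D 2 1 * x₂ + D 2 2 * x₃;
     0, 0, 0, 0, 0]

/-- The matrices of the commutative table. -/
def CommRow.mat : CommRow F → F → F → F → F → Matrix (Fin 5) (Fin 5) F
  | .S5, x₁, x₂, x₃, x₄ =>
    !![0, x₁, x₂, x₃, x₄;
       0, 0, x₁, x₂, x₃;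
       0, 0, 0, x₁, x₂;
       0, 0, 0, 0, x₁;
       0, 0, 0, 0, 0]
  | .S41, x₁, x₂, x₃, x₄ =>
    !![0, x₁, x₂, x₃, x₄;
       0, 0, x₁, x₂, 0;
       0, 0, 0, x₁, 0;
       0, 0, 0, 0, 0;
       0, 0, 0, 0, 0]
  | .S32sharp, x₁, x₂, x₃, x₄ =>
    !![0, x₁, x₂, x₃, x₄;
       0, 0, x₁, 0, x₂;
       0, 0, 0, 0, x₁;
       0, 0, 0, 0, x₃;
       0, 0, 0, 0, 0]
  | .U1_00, x₁, x₂, x₃, x₄ =>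
    !![0, x₁, x₂, x₃, x₄;
       0, 0, 0, x₁, x₂;
       0, 0, 0, 0, x₁;
       0, 0, 0, 0, 0;
       0, 0, 0, 0, 0]
  | .U1_0 ρ, x₁, x₂, x₃, x₄ =>
    !![0, x₁, x₂, x₃, x₄;
       0, 0, 0, x₁, x₂;
       0, 0, 0, ρ * x₂, x₁;
       0, 0, 0, 0, 0;
       0, 0, 0, 0, 0]
  | .U1_1 ε, x₁, x₂, x₃, x₄ =>
    !![0, x₁, x₂, x₃, x₄;
       0, 0, 0, x₁, x₂;
       0, 0, 0, ε * x₂, x₁ + x₂;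
       0, 0, 0, 0, 0;
       0, 0, 0, 0, 0]
  | .RD D, x₁, x₂, x₃, x₄ => matRD D x₁ x₂ x₃ x₄

/-- The matrices of the noncommutative table. -/
def NoncommRow.mat : NoncommRow F → F → F → F → F → Matrix (Fin 5) (Fin 5) F
  | .U2_01011, x₁, x₂, x₃, x₄ =>
    !![0, x₁, x₂, x₃, x₄;
       0, 0, x₁, 0, x₂ + x₃;
       0, 0, 0, 0, x₁;
       0, 0, 0, 0, x₃;
       0, 0, 0, 0, 0]
  | .U2_01001, x₁, x₂, x₃, x₄ =>
    !![0, x₁, x₂, x₃, x₄;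
       0, 0, x₁, 0, x₂ + x₃;
       0, 0, 0, 0, x₁;
       0, 0, 0, 0, 0;
       0, 0, 0, 0, 0]
  | .U3_010, x₁, x₂, x₃, x₄ =>
    !![0, x₁, x₂, x₃, x₄;
       0, 0, x₁, 0, 0;
       0, 0, 0, 0, 0;
       0, 0, 0, 0, x₁;
       0, 0, 0, 0, 0]
  | .U3_011, x₁, x₂, x₃, x₄ =>
    !![0, x₁, x₂, x₃, x₄;
       0, 0, x₁, 0, 0;
       0, 0, 0, 0, 0;
       0, 0, 0, 0, x₁ + x₃;
       0, 0, 0, 0, 0]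
  | .U3_1 l, x₁, x₂, x₃, x₄ =>
    !![0, x₁, x₂, x₃, x₄;
       0, 0, x₁, 0, x₃;
       0, 0, 0, 0, 0;
       0, 0, 0, 0, l * x₁;
       0, 0, 0, 0, 0]
  | .U4 ρ β₁ β₂, x₁, x₂, x₃, x₄ =>
    !![0, x₁, x₂, x₃, x₄;
       0, 0, 0, x₁, x₂;
       0, 0, 0, ρ * x₂, β₁ * x₁ + β₂ * x₂;
       0, 0, 0, 0, 0;
       0, 0, 0, 0, 0]
  | .U5_11 ε, x₁, x₂, x₃, x₄ =>
    !![0, x₁, x₂, x₃, x₄;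
       0, 0, 0, x₂, x₁ + x₂;
       0, 0, 0, x₁, ε * x₂;
       0, 0, 0, 0, 0;
       0, 0, 0, 0, 0]
  | .RD D, x₁, x₂, x₃, x₄ => matRD D x₁ x₂ x₃ x₄

lemma vec5_zero : (0 : Fin 5 → F) = ![0, 0, 0, 0, 0] := by
  ext i
  fin_cases i <;> rfl

lemma CommRow.mat_add (r : CommRow F) (a b c d a' b' c' d' : F) :
    r.mat a b c d + r.mat a' b' c' d' = r.mat (a + a') (b + b') (c + c') (d + d') := by
  cases r <;> simp [CommRow.mat, matRD] <;> try ring_nf <;> simp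

lemma CommRow.mat_smul (r : CommRow F) (k a b c d : F) :
    k • r.mat a b c d = r.mat (k * a) (k * b) (k * c) (k * d) := by
  cases r <;> simp [CommRow.mat, matRD] <;> try ring_nf <;> simp

lemma CommRow.mat_zero (r : CommRow F) : r.mat 0 0 0 0 = 0 := by
  simpa using (r.mat_smul 0 0 0 0 0).symm

lemma CommRow.mat_mul (r : CommRow F) (a b c d a' b' c' d' : F) :
    ∃ x₂ x₃ x₄ : F, r.mat a b c d * r.mat a' b' c' d' = r.mat 0 x₂ x₃ x₄ := by
  cases r
  case S5 =>
    refine ⟨a * a', a * b' + b * a', a * c' + b * b' + c * a', ?_⟩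
    simp [CommRow.mat, add_assoc, vec5_zero]
  case S41 =>
    refine ⟨a * a', a * b' + b * a', 0, ?_⟩
    simp [CommRow.mat, vec5_zero]
  case S32sharp =>
    refine ⟨a * a', 0, a * b' + b * a' + c * c', ?_⟩
    simp [CommRow.mat, add_assoc, vec5_zero]
  case U1_00 =>
    refine ⟨0, a * a', a * b' + b * a', ?_⟩
    simp [CommRow.mat, vec5_zero]
  case U1_0 ρ =>
    refine ⟨0, a * a' + b * (ρ * b'), a * b' + b * a', ?_⟩
    simp [CommRow.mat, vec5_zero]
  case U1_1 ε =>
    refine ⟨0, a * a' + b * (ε * b'), a * b' + b * (a' + b'), ?_⟩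
    simp [CommRow.mat, vec5_zero]
  case RD D =>
    refine ⟨0, 0, a * (D 0 0 * a' + D 0 1 * b' + D 0 2 * c') +
      b * (D 1 0 * a' + D 1 1 * b' + D 1 2 * c') +
      c * (D 2 0 * a' + D 2 1 * b' + D 2 2 * c'), ?_⟩
    simp [CommRow.mat, matRD, add_assoc, vec5_zero]

lemma NoncommRow.mat_add (r : NoncommRow F) (a b c d a' b' c' d' : F) :
    r.mat a b c d + r.mat a' b' c' d' = r.mat (a + a') (b + b') (c + c') (d + d') := by
  cases r <;> simp [NoncommRow.mat, matRD] <;> try ring_nf <;> simp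

lemma NoncommRow.mat_smul (r : NoncommRow F) (k a b c d : F) :
    k • r.mat a b c d = r.mat (k * a) (k * b) (k * c) (k * d) := by
  cases r <;> simp [NoncommRow.mat, matRD] <;> try ring_nf <;> simp

lemma NoncommRow.mat_zero (r : NoncommRow F) : r.mat 0 0 0 0 = 0 := by
  simpa using (r.mat_smul 0 0 0 0 0).symm

lemma NoncommRow.mat_mul (r : NoncommRow F) (a b c d a' b' c' d' : F) :
    ∃ x₂ x₃ x₄ : F, r.mat a b c d * r.mat a' b' c' d' = r.mat 0 x₂ x₃ x₄ := by
  cases r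
  case U2_01011 =>
    refine ⟨a * a', 0, a * (b' + c') + b * a' + c * c', ?_⟩
    simp [NoncommRow.mat, add_assoc, vec5_zero]
  case U2_01001 =>
    refine ⟨a * a', 0, a * (b' + c') + b * a', ?_⟩
    simp [NoncommRow.mat, vec5_zero]
  case U3_010 =>
    refine ⟨a * a', 0, c * a', ?_⟩
    simp [NoncommRow.mat, vec5_zero]
  case U3_011 =>
    refine ⟨a * a', 0, c * (a' + c'), ?_⟩
    simp [NoncommRow.mat, vec5_zero]
  case U3_1 l =>
    refine ⟨a * a', 0, a * c' + c * (l * a'), ?_⟩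
    simp [NoncommRow.mat, vec5_zero]
  case U4 ρ β₁ β₂ =>
    refine ⟨0, a * a' + b * (ρ * b'), a * b' + b * (β₁ * a' + β₂ * b'), ?_⟩
    simp [NoncommRow.mat, vec5_zero]
  case U5_11 ε =>
    refine ⟨0, a * b' + b * a', a * (a' + b') + b * (ε * b'), ?_⟩
    simp [NoncommRow.mat, vec5_zero]
  case RD D =>
    refine ⟨0, 0, a * (D 0 0 * a' + D 0 1 * b' + D 0 2 * c') +
      b * (D 1 0 * a' + D 1 1 * b' + D 1 2 * c') +
      c * (D 2 0 * a' + D 2 1 * b' + D 2 2 * c'), ?_⟩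
    simp [NoncommRow.mat, matRD, add_assoc, vec5_zero]

/-- The algebra of all matrices on a line of the commutative table, under matrix addition,
multiplication and scaling. -/
def CommRow.algebra (r : CommRow F) : NonUnitalSubalgebra F (Matrix (Fin 5) (Fin 5) F) where
  carrier := {m | ∃ x₁ x₂ x₃ x₄ : F, m = r.mat x₁ x₂ x₃ x₄}
  zero_mem' := ⟨0, 0, 0, 0, r.mat_zero.symm⟩
  add_mem' := by
    rintro _ _ ⟨a, b, c, d, rfl⟩ ⟨a', b', c', d', rfl⟩
    exact ⟨_, _, _, _, r.mat_add a b c d a' b' c' d'⟩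
  mul_mem' := by
    rintro _ _ ⟨a, b, c, d, rfl⟩ ⟨a', b', c', d', rfl⟩
    exact ⟨0, r.mat_mul a b c d a' b' c' d'⟩
  smul_mem' := by
    rintro k _ ⟨a, b, c, d, rfl⟩
    exact ⟨_, _, _, _, r.mat_smul k a b c d⟩

/-- The algebra of all matrices on a line of the noncommutative table, under matrix addition,
multiplication and scaling. -/
def NoncommRow.algebra (r : NoncommRow F) :
    NonUnitalSubalgebra F (Matrix (Fin 5) (Fin 5) F) where
  carrier := {m | ∃ x₁ x₂ x₃ x₄ : F, m = r.mat x₁ x₂ x₃ x₄}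
  zero_mem' := ⟨0, 0, 0, 0, r.mat_zero.symm⟩
  add_mem' := by
    rintro _ _ ⟨a, b, c, d, rfl⟩ ⟨a', b', c', d', rfl⟩
    exact ⟨_, _, _, _, r.mat_add a b c d a' b' c' d'⟩
  mul_mem' := by
    rintro _ _ ⟨a, b, c, d, rfl⟩ ⟨a', b', c', d', rfl⟩
    exact ⟨0, r.mat_mul a b c d a' b' c' d'⟩
  smul_mem' := by
    rintro k _ ⟨a, b, c, d, rfl⟩
    exact ⟨_, _, _, _, r.mat_smul k a b c d⟩

/-- The conditions in the commutative table: `Q` stands for the transversal of the squares, `B` and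
`C` for the two further sets in characteristic two, `PS` for the symmetric matrices. -/
def CommRow.Listed (Q B C : Set F) (PS : Set (Matrix (Fin 3) (Fin 3) F)) : CommRow F → Prop
  | .S5 => True
  | .S41 => True
  | .S32sharp => True
  | .U1_00 => ringChar F ≠ 2
  | .U1_0 ρ => (ringChar F ≠ 2 ∧ ρ ∈ Q) ∨ (ringChar F = 2 ∧ ρ ∈ C)
  | .U1_1 ε => ringChar F = 2 ∧ ε ∈ B
  | .RD D => D ∈ PS

/-- The conditions in the noncommutative table; `A ρ` stands for the set of representatives of
`ARel ρ` and `PA` for the asymmetric matrices. -/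
def NoncommRow.Listed (Q B : Set F) (A : F → Set (F × F))
    (PA : Set (Matrix (Fin 3) (Fin 3) F)) : NoncommRow F → Prop
  | .U2_01011 => True
  | .U2_01001 => True
  | .U3_010 => True
  | .U3_011 => True
  | .U3_1 l => l ≠ 1
  | .U4 ρ β₁ β₂ => ρ ∈ Q ∧ (β₁, β₂) ∈ A ρ
  | .U5_11 ε => ringChar F = 2 ∧ ε ∈ B
  | .RD D => D ∈ PA

end Tables

end NilpAlg

namespace NilpAlg

/-! ### Isomorphisms of algebras. -/

section Iso

variable {F : Type*} [Field F]

/-! The powers of a nilpotent algebra `N` decrease strictly until they vanish, so few dimension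
sequences occur in dimension four. If `N²` has codimension one, then `N` is generated by one
element. If its codimension is larger and `N³ ≠ 0`, the dimensions are 4, 2, 1, 0: associativity
forces some cube to be nonzero (`exists_cube_ne_zero`), a second generator can be corrected until
only two scalars remain (`exists_generators`), and rescaling turns these into 0 or 1.

If `N³ = 0`, the product is a bilinear map `V × V → W` with `W` annihilating `N` and containing `N²`
(`exists_presentedBy`). With `dim W = 1` it is a single form in three variables, classified by
projective congruence. With `dim N² = 2` it is a pair of independent binary forms, taken up to base
change in `V` and in `W`. Uniqueness rests on `PresentedBy.comparison`: independent forms make `W`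
equal to `N²`, so an isomorphism induces the two base changes.

A pair of symmetric forms reduces to `e₂² = ρ e₁² + a e₁e₂` (`exists_commPair`). Completing the
square leaves `ρ` modulo squares if 2 is invertible; in characteristic two the cases `a = 0` and `a
= 1` lead to `StarRel` and to Artin-Schreier classes. A pencil with an asymmetric member has exactly
one nonzero symmetric member up to scalars. This member has rank one (`U3`), or is diagonal and
nondegenerate (`U4`), or is alternating (`U5`, characteristic two); the base changes preserving it
up to a scalar then act on the second form, and `ARel` describes this action for `U4`
(`aRel_of_diagPair`). -/

lemma AlgIso.symm {N M : Type*} [NonUnitalRing N] [Module F N] [NonUnitalRing M] [Module F M]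
    (h : AlgIso F N M) : AlgIso F M N := by
  obtain ⟨f, hf⟩ := h
  let e : N ≃ M := Equiv.ofBijective f hf
  have he : ∀ x, f (e.symm x) = x := fun x => e.apply_symm_apply x
  refine ⟨{ toFun := e.symm, map_smul' := ?_, map_zero' := ?_, map_add' := ?_, map_mul' := ?_ },
    e.symm.bijective⟩
  · intro c x
    apply hf.1
    simp [he]
  · apply hf.1
    simp [he]
  · intro x y
    apply hf.1
    simp [he]
  · intro x y
    apply hf.1
    simp [he]

/-- A linear equivalence compatible with the products is an isomorphism of algebras. -/
lemma AlgIso.of_linearEquiv {N M : Type*} [NonUnitalRing N] [Module F N] [NonUnitalRing M]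
    [Module F M] (f : N ≃ₗ[F] M) (hf : ∀ x y, f (x * y) = f x * f y) : AlgIso F N M :=
  ⟨{ toFun := f, map_smul' := by simp, map_zero' := by simp, map_add' := by simp,
     map_mul' := hf }, f.bijective⟩

end Iso

/-! ### Algebras with zero cube as families of bilinear forms. -/

section Presentations

variable {F : Type*} [Field F] {m n : ℕ}

/-- The vector-valued bilinear map attached to a family of matrices. -/
def formVec (S : Fin m → Matrix (Fin n) (Fin n) F) (v w : Fin n → F) : Fin m → F :=
  fun k => v ⬝ᵥ (S k).mulVec w

/-- `N` is isomorphic to the algebra with underlying space `V × W` in which the product takes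
values in the annihilating subspace `W` and is given by the bilinear forms `S k` on `V`. -/
def PresentedBy (N : Type*) [NonUnitalRing N] [Module F N]
    (S : Fin m → Matrix (Fin n) (Fin n) F) : Prop :=
  ∃ f : N ≃ₗ[F] (Fin n → F) × (Fin m → F), ∀ x y, f (x * y) = (0, formVec S (f x).1 (f y).1)

variable {N M : Type*} [NonUnitalRing N] [Module F N] [NonUnitalRing M] [Module F M]

lemma PresentedBy.of_algIso {S : Fin m → Matrix (Fin n) (Fin n) F} (hM : PresentedBy M S)
    (h : AlgIso F N M) : PresentedBy N S := by
  obtain ⟨f, hf⟩ := h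
  obtain ⟨g, hg⟩ := hM
  let e : N ≃ₗ[F] M := LinearEquiv.ofBijective (f : N →ₗ[F] M) hf
  have he : ∀ x, e x = f x := fun x => rfl
  refine ⟨e.trans g, fun x y => ?_⟩
  simp [he, hg]

lemma PresentedBy.algIso {S : Fin m → Matrix (Fin n) (Fin n) F} (hN : PresentedBy N S)
    (hM : PresentedBy M S) : AlgIso F N M := by
  obtain ⟨f, hf⟩ := hN
  obtain ⟨g, hg⟩ := hM
  refine AlgIso.of_linearEquiv (f.trans g.symm) fun x y => ?_
  apply g.injective
  simp [hf, hg]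

lemma PresentedBy.of_symm {S : Fin m → Matrix (Fin n) (Fin n) F}
    (f : ((Fin n → F) × (Fin m → F)) ≃ₗ[F] N)
    (hf : ∀ x y, f x * f y = f (0, formVec S x.1 y.1)) : PresentedBy N S := by
  refine ⟨f.symm, fun x y => ?_⟩
  apply f.injective
  rw [← hf]
  simp

lemma PresentedBy.mul_mul_eq_zero {S : Fin m → Matrix (Fin n) (Fin n) F} (hN : PresentedBy N S)
    (x y z : N) : x * y * z = 0 := by
  obtain ⟨f, hf⟩ := hN
  apply f.injective
  rw [hf, hf, map_zero]
  ext i <;> simp [formVec]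

lemma formVec_basis (S : Fin m → Matrix (Fin n) (Fin n) F) (i j : Fin n) (k : Fin m) :
    formVec S (Pi.single i 1) (Pi.single j 1) k = S k i j := by
  simp [formVec]

lemma formVec_transpose {S : Fin m → Matrix (Fin n) (Fin n) F}
    (h : ∀ k, (S k).transpose = S k) (v w : Fin n → F) : formVec S v w = formVec S w v := by
  ext k
  unfold formVec
  rw [← h k, Matrix.mulVec_transpose, dotProduct_comm, h k, ← Matrix.dotProduct_mulVec]

/-- An algebra presented by bilinear forms is commutative if and only if they are symmetric. -/
lemma PresentedBy.comm_iff {S : Fin m → Matrix (Fin n) (Fin n) F} (hN : PresentedBy N S) :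
    (∀ x y : N, x * y = y * x) ↔ ∀ k, (S k).transpose = S k := by
  obtain ⟨f, hf⟩ := hN
  constructor
  · intro h k
    ext i j
    have := congrArg f (h (f.symm (Pi.single j 1, 0)) (f.symm (Pi.single i 1, 0)))
    rw [hf, hf] at this
    have := congrFun (Prod.ext_iff.1 this).2 k
    simpa [formVec_basis] using this
  · intro h x y
    apply f.injective
    rw [hf, hf, formVec_transpose h]

/-- Families of forms that agree up to base changes in the source and in the target. -/
def FormsSim {m n : ℕ} (S S' : Fin m → Matrix (Fin n) (Fin n) F) : Prop :=
  ∃ (P : Matrix (Fin n) (Fin n) F) (Q : Matrix (Fin m) (Fin m) F), IsUnit P ∧ IsUnit Q ∧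
    ∀ k, P * S k * P.transpose = ∑ l, Q k l • S' l

lemma formVec_vecMul (S : Fin m → Matrix (Fin n) (Fin n) F) (P : Matrix (Fin n) (Fin n) F)
    (v w : Fin n → F) :
    formVec S (P.transpose.mulVec v) (P.transpose.mulVec w) =
      formVec (fun k => P * S k * P.transpose) v w := by
  ext k
  simp only [formVec]
  rw [Matrix.mulVec_transpose, ← Matrix.dotProduct_mulVec, Matrix.mulVec_mulVec,
    Matrix.mulVec_mulVec, Matrix.mul_assoc]

lemma formVec_sum (S : Fin m → Matrix (Fin n) (Fin n) F) (Q : Matrix (Fin m) (Fin m) F)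
    (v w : Fin n → F) :
    formVec (fun k => ∑ l, Q k l • S l) v w = Q.mulVec (formVec S v w) := by
  ext k
  simp only [formVec, Matrix.sum_mulVec, Matrix.smul_mulVec, dotProduct_sum, dotProduct_smul]
  rfl

lemma PresentedBy.of_formsSim {S S' : Fin m → Matrix (Fin n) (Fin n) F} (hN : PresentedBy N S)
    (h : FormsSim S S') : PresentedBy N S' := by
  obtain ⟨f, hf⟩ := hN
  obtain ⟨P, Q, hP, hQ, h⟩ := h
  let p : (Fin n → F) ≃ₗ[F] (Fin n → F) :=
    LinearEquiv.ofBijective P.transpose.mulVecLin (by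
      have := (Matrix.isUnit_transpose P).2 hP
      exact ⟨Matrix.mulVec_injective_of_isUnit this, Matrix.mulVec_surjective_iff_isUnit.2 this⟩)
  let q : (Fin m → F) ≃ₗ[F] (Fin m → F) :=
    LinearEquiv.ofBijective Q.mulVecLin
      ⟨Matrix.mulVec_injective_of_isUnit hQ, Matrix.mulVec_surjective_iff_isUnit.2 hQ⟩
  refine PresentedBy.of_symm ((p.prodCongr q).trans f.symm) fun x y => ?_
  apply f.injective
  have hp : ∀ v, p v = P.transpose.mulVec v := fun v => rfl
  have hq : ∀ v, q v = Q.mulVec v := fun v => rfl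
  simp [hf, hp, hq, formVec_vecMul, h, formVec_sum]

/-- The linear independence of a family of forms, in coordinates. -/
def FormsIndep (S : Fin m → Matrix (Fin n) (Fin n) F) : Prop :=
  ∀ c : Fin m → F, ∑ k, c k • S k = 0 → c = 0

lemma dotProduct_formVec (S : Fin m → Matrix (Fin n) (Fin n) F) (c : Fin m → F)
    (v w : Fin n → F) : c ⬝ᵥ formVec S v w = v ⬝ᵥ (∑ k, c k • S k).mulVec w := by
  simp only [Matrix.sum_mulVec, Matrix.smul_mulVec, dotProduct_sum, dotProduct_smul]
  rfl

lemma dotProduct_formVec_single (S : Fin m → Matrix (Fin n) (Fin n) F) (c : Fin m → F)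
    (i j : Fin n) :
    c ⬝ᵥ formVec S (Pi.single i 1) (Pi.single j 1) = (∑ k, c k • S k) i j := by
  simp [dotProduct, formVec_basis, Matrix.sum_apply]

/-- Two presentations of the same algebra, the first one by independent forms, differ by base
changes. -/
lemma PresentedBy.comparison {m' n' : ℕ} {S : Fin m → Matrix (Fin n) (Fin n) F}
    {S' : Fin m' → Matrix (Fin n') (Fin n') F} (hS : FormsIndep S) (h : PresentedBy N S)
    (h' : PresentedBy N S') :
    ∃ (p : (Fin n → F) →ₗ[F] (Fin n' → F)) (q : (Fin m → F) →ₗ[F] (Fin m' → F)),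
      Function.Surjective p ∧ Function.Injective q ∧
        ∀ v w, formVec S' (p v) (p w) = q (formVec S v w) := by
  obtain ⟨f, hf⟩ := h
  obtain ⟨g, hg⟩ := h'
  let e := f.symm.trans g
  have he : ∀ x y, e (0, formVec S x.1 y.1) = (0, formVec S' (e x).1 (e y).1) := by
    intro x y
    have := hg (f.symm x) (f.symm y)
    rw [show f.symm x * f.symm y = f.symm (0, formVec S x.1 y.1) from
      f.injective (by simp [hf])] at this
    exact this
  -- Each coordinate of `w ↦ (e (0, w)).1` is a linear functional that vanishes on all products,
  -- hence gives a linear relation between the forms `S k`; independence makes it zero. So `e` maps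
  -- `W` into `W'`.
  have hr : ∀ w : Fin m → F, (e (0, w)).1 = 0 := by
    intro w
    ext i
    let r : (Fin m → F) →ₗ[F] F :=
      LinearMap.proj i ∘ₗ LinearMap.fst F _ _ ∘ₗ e.toLinearMap ∘ₗ LinearMap.inr F _ _
    have hr : ∀ w, r w = (e (0, w)).1 i := fun w => rfl
    have hrc : ∀ w, r w = (fun k => r (Pi.single k 1)) ⬝ᵥ w := by
      intro w
      conv_lhs => rw [← Finset.univ_sum_single w, map_sum]
      refine Finset.sum_congr rfl fun k _ => ?_
      rw [mul_comm, ← smul_eq_mul, ← map_smul, ← Pi.single_smul, smul_eq_mul, mul_one]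
    have hc := hS (fun k => r (Pi.single k 1)) (by
      ext a b
      rw [← dotProduct_formVec_single, ← hrc, hr, he (Pi.single a 1, 0) (Pi.single b 1, 0)]
      rfl)
    rw [← hr, hrc, hc]
    simp
  have hsplit : ∀ v w, e (v, w) = e (v, 0) + e (0, w) := by
    intro v w
    rw [← map_add]
    simp
  refine ⟨LinearMap.fst F _ _ ∘ₗ e.toLinearMap ∘ₗ LinearMap.inl F _ _,
    LinearMap.snd F _ _ ∘ₗ e.toLinearMap ∘ₗ LinearMap.inr F _ _, fun v => ?_, ?_, fun v w => ?_⟩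
  · obtain ⟨⟨x, y⟩, hx⟩ := e.surjective (v, 0)
    refine ⟨x, ?_⟩
    have := congrArg Prod.fst hx
    rw [hsplit] at this
    simpa [hr] using this
  · rw [← LinearMap.ker_eq_bot, LinearMap.ker_eq_bot']
    intro w hw
    have : e (0, w) = 0 := Prod.ext (hr w) hw
    simpa using this
  · simpa using (congrArg Prod.snd (he (v, 0) (w, 0))).symm

/-- For independent forms the target is exactly the square of the algebra, whereas any other
presentation has a target that merely contains the square. -/
lemma PresentedBy.card_le {m' n' : ℕ} {S : Fin m → Matrix (Fin n) (Fin n) F}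
    {S' : Fin m' → Matrix (Fin n') (Fin n') F} (hS : FormsIndep S) (h : PresentedBy N S)
    (h' : PresentedBy N S') : m ≤ m' := by
  obtain ⟨p, q, -, hq, -⟩ := h.comparison hS h'
  simpa using LinearMap.finrank_le_finrank_of_injective hq

/-- Presentations of the same algebra by independent forms of the same size are similar. -/
lemma PresentedBy.formsSim {S S' : Fin m → Matrix (Fin n) (Fin n) F} (hS : FormsIndep S)
    (h : PresentedBy N S) (h' : PresentedBy N S') : FormsSim S' S := by
  obtain ⟨p, q, hp, hq, hpq⟩ := h.comparison hS h'
  have hp' : IsUnit (LinearMap.toMatrix' p) := by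
    rw [← Matrix.mulVec_surjective_iff_isUnit]
    intro v
    obtain ⟨w, rfl⟩ := hp v
    exact ⟨w, by simp⟩
  have hq' : IsUnit (LinearMap.toMatrix' q) := by
    rw [← Matrix.mulVec_injective_iff_isUnit]
    intro v w hvw
    exact hq (by simpa using hvw)
  refine ⟨(LinearMap.toMatrix' p).transpose, LinearMap.toMatrix' q,
    (Matrix.isUnit_transpose _).2 hp', hq', fun k => ?_⟩
  ext i j
  have := congrFun (hpq (Pi.single i 1) (Pi.single j 1)) k
  rw [← LinearMap.toMatrix'_mulVec q, ← formVec_sum, formVec_basis,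
    ← LinearMap.toMatrix'_mulVec p, ← LinearMap.toMatrix'_mulVec p] at this
  rw [← this, ← formVec_basis (fun k => _ * S' k * _) i j k, ← formVec_vecMul]
  simp

end Presentations

/-! ### The matrix algebras of the tables: coordinates, nilpotency, presentations. -/

section Rows

variable {F : Type*} [Field F]

/-- The first row of a matrix records its four parameters, which makes the parametrization
injective. -/
lemma exists_coord (A : NonUnitalSubalgebra F (Matrix (Fin 5) (Fin 5) F))
    (g : F → F → F → F → Matrix (Fin 5) (Fin 5) F)
    (hA : ∀ m, m ∈ A ↔ ∃ a b c d, m = g a b c d)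
    (hadd : ∀ a b c d a' b' c' d', g a b c d + g a' b' c' d' = g (a + a') (b + b') (c + c') (d + d'))
    (hsmul : ∀ k a b c d, k • g a b c d = g (k * a) (k * b) (k * c) (k * d))
    (hrow : ∀ a b c d, g a b c d 0 = ![0, a, b, c, d]) :
    ∃ e : (Fin 4 → F) ≃ₗ[F] A,
      ∀ x, (e x : Matrix (Fin 5) (Fin 5) F) = g (x 0) (x 1) (x 2) (x 3) := by
  let l : (Fin 4 → F) →ₗ[F] A :=
    { toFun := fun x => ⟨g (x 0) (x 1) (x 2) (x 3), (hA _).2 ⟨_, _, _, _, rfl⟩⟩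
      map_add' := fun x y => Subtype.ext (by simp [hadd])
      map_smul' := fun k x => Subtype.ext (by simp [hsmul]) }
  have hl : ∀ x, (l x : Matrix (Fin 5) (Fin 5) F) = g (x 0) (x 1) (x 2) (x 3) := fun x => rfl
  refine ⟨LinearEquiv.ofBijective l ⟨fun x y hxy => ?_, fun ⟨m, hm⟩ => ?_⟩, hl⟩
  · have h := congrFun (congrArg Subtype.val hxy) 0
    rw [hl, hl, hrow, hrow] at h
    ext i
    have h1 := congrFun h 1
    have h2 := congrFun h 2
    have h3 := congrFun h 3
    have h4 := congrFun h 4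
    fin_cases i
    · simpa using h1
    · simpa using h2
    · simpa using h3
    · simpa using h4
  · obtain ⟨a, b, c, d, rfl⟩ := (hA m).1 hm
    exact ⟨![a, b, c, d], Subtype.ext (by simp [hl])⟩

lemma CommRow.exists_coord (r : CommRow F) : ∃ e : (Fin 4 → F) ≃ₗ[F] r.algebra,
    ∀ x, (e x : Matrix (Fin 5) (Fin 5) F) = r.mat (x 0) (x 1) (x 2) (x 3) :=
  NilpAlg.exists_coord _ _ (fun _ => Iff.rfl) r.mat_add r.mat_smul (by
    intros
    cases r <;> rfl)

lemma NoncommRow.exists_coord (r : NoncommRow F) : ∃ e : (Fin 4 → F) ≃ₗ[F] r.algebra,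
    ∀ x, (e x : Matrix (Fin 5) (Fin 5) F) = r.mat (x 0) (x 1) (x 2) (x 3) :=
  NilpAlg.exists_coord _ _ (fun _ => Iff.rfl) r.mat_add r.mat_smul (by
    intros
    cases r <;> rfl)

lemma CommRow.finrank_algebra (r : CommRow F) : Module.finrank F r.algebra = 4 := by
  obtain ⟨e, -⟩ := r.exists_coord
  simpa using e.symm.finrank_eq

lemma NoncommRow.finrank_algebra (r : NoncommRow F) : Module.finrank F r.algebra = 4 := by
  obtain ⟨e, -⟩ := r.exists_coord
  simpa using e.symm.finrank_eq

/-- An algebra of strictly upper triangular matrices is nilpotent. -/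
lemma isNilpotentAlgebra_of_strictUpper {n : ℕ}
    (A : NonUnitalSubalgebra F (Matrix (Fin n) (Fin n) F))
    (hA : ∀ m ∈ A, ∀ i j : Fin n, j ≤ i → m i j = 0) : IsNilpotentAlgebra F A := by
  -- Each multiplication by a strictly upper triangular matrix moves the support one diagonal
  -- further up; `npow F A k` is the power with exponent `k + 1`.
  have key : ∀ k, ∀ m ∈ npow F A k, ∀ i j : Fin n, (j : ℕ) ≤ i + k →
      (m : Matrix (Fin n) (Fin n) F) i j = 0 := by
    intro k
    induction k with
    | zero => exact fun m _ i j hij => hA m m.2 i j (by simpa using hij)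
    | succ k ih =>
      intro m hm
      induction hm using Submodule.span_induction with
      | mem z hz =>
        obtain ⟨x, hx, y, rfl⟩ := hz
        intro i j hij
        rw [NonUnitalSubalgebra.coe_mul, Matrix.mul_apply]
        refine Finset.sum_eq_zero fun l _ => ?_
        by_cases hl : (l : ℕ) ≤ i + k
        · rw [ih x hx i l hl, zero_mul]
        · rw [hA y y.2 l j (Fin.le_def.2 (by omega)), mul_zero]
      | zero => simp
      | add x y _ _ hx hy =>
        intro i j hij
        simp [hx i j hij, hy i j hij]
      | smul a x _ hx =>
        intro i j hij
        simp [hx i j hij]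
  refine ⟨n, (Submodule.eq_bot_iff _).2 fun m hm => Subtype.ext ?_⟩
  ext i j
  exact key n m hm i j (by omega)

lemma CommRow.isNilpotentAlgebra (r : CommRow F) : IsNilpotentAlgebra F r.algebra := by
  refine isNilpotentAlgebra_of_strictUpper _ ?_
  rintro _ ⟨a, b, c, d, rfl⟩ i j hij
  cases r <;> fin_cases i <;> fin_cases j <;> first | rfl | exact absurd hij (by decide)

lemma NoncommRow.isNilpotentAlgebra (r : NoncommRow F) : IsNilpotentAlgebra F r.algebra := by
  refine isNilpotentAlgebra_of_strictUpper _ ?_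
  rintro _ ⟨a, b, c, d, rfl⟩ i j hij
  cases r <;> fin_cases i <;> fin_cases j <;> first | rfl | exact absurd hij (by decide)

/-- Coordinates `(x₁, x₂), (x₃, x₄)`. -/
def pairCoord : ((Fin 2 → F) × (Fin 2 → F)) ≃ₗ[F] (Fin 4 → F) where
  toFun x := ![x.1 0, x.1 1, x.2 0, x.2 1]
  invFun y := (![y 0, y 1], ![y 2, y 3])
  map_add' x y := by simp
  map_smul' k x := by simp
  left_inv x := by ext i <;> fin_cases i <;> rfl
  right_inv y := by ext i; fin_cases i <;> rfl

/-- Coordinates `(x₁, x₃), (x₂, x₄)`. -/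
def altPairCoord : ((Fin 2 → F) × (Fin 2 → F)) ≃ₗ[F] (Fin 4 → F) where
  toFun x := ![x.1 0, x.2 0, x.1 1, x.2 1]
  invFun y := (![y 0, y 2], ![y 1, y 3])
  map_add' x y := by simp
  map_smul' k x := by simp
  left_inv x := by ext i <;> fin_cases i <;> rfl
  right_inv y := by ext i; fin_cases i <;> rfl

/-- Coordinates `(x₁, x₂, x₃), x₄`. -/
def formCoord : ((Fin 3 → F) × (Fin 1 → F)) ≃ₗ[F] (Fin 4 → F) where
  toFun x := ![x.1 0, x.1 1, x.1 2, x.2 0]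
  invFun y := (![y 0, y 1, y 2], ![y 3])
  map_add' x y := by simp
  map_smul' k x := by simp
  left_inv x := by ext i <;> fin_cases i <;> rfl
  right_inv y := by ext i; fin_cases i <;> rfl

lemma CommRow.presentedBy {m n : ℕ} (r : CommRow F)
    (u : ((Fin n → F) × (Fin m → F)) ≃ₗ[F] (Fin 4 → F)) (S : Fin m → Matrix (Fin n) (Fin n) F)
    (h : ∀ v w v' w', r.mat (u (v, w) 0) (u (v, w) 1) (u (v, w) 2) (u (v, w) 3) *
      r.mat (u (v', w') 0) (u (v', w') 1) (u (v', w') 2) (u (v', w') 3) =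
      r.mat (u (0, formVec S v v') 0) (u (0, formVec S v v') 1) (u (0, formVec S v v') 2)
        (u (0, formVec S v v') 3)) : PresentedBy r.algebra S := by
  obtain ⟨e, he⟩ := r.exists_coord
  refine PresentedBy.of_symm (u.trans e) fun x y => Subtype.ext ?_
  rw [NonUnitalSubalgebra.coe_mul, LinearEquiv.trans_apply, LinearEquiv.trans_apply,
    LinearEquiv.trans_apply, he, he, he]
  exact h x.1 x.2 y.1 y.2

lemma NoncommRow.presentedBy {m n : ℕ} (r : NoncommRow F)
    (u : ((Fin n → F) × (Fin m → F)) ≃ₗ[F] (Fin 4 → F)) (S : Fin m → Matrix (Fin n) (Fin n) F)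
    (h : ∀ v w v' w', r.mat (u (v, w) 0) (u (v, w) 1) (u (v, w) 2) (u (v, w) 3) *
      r.mat (u (v', w') 0) (u (v', w') 1) (u (v', w') 2) (u (v', w') 3) =
      r.mat (u (0, formVec S v v') 0) (u (0, formVec S v v') 1) (u (0, formVec S v v') 2)
        (u (0, formVec S v v') 3)) : PresentedBy r.algebra S := by
  obtain ⟨e, he⟩ := r.exists_coord
  refine PresentedBy.of_symm (u.trans e) fun x y => Subtype.ext ?_
  rw [NonUnitalSubalgebra.coe_mul, LinearEquiv.trans_apply, LinearEquiv.trans_apply,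
    LinearEquiv.trans_apply, he, he, he]
  exact h x.1 x.2 y.1 y.2

lemma presentedBy_commRow_RD (D : Matrix (Fin 3) (Fin 3) F) :
    PresentedBy (CommRow.RD D).algebra (fun _ : Fin 1 => D) := by
  refine CommRow.presentedBy _ formCoord _ fun v w v' w' => ?_
  simp [formCoord, CommRow.mat, matRD, formVec, Matrix.mulVec, dotProduct, Fin.sum_univ_succ,
    vec5_zero, mul_add, add_assoc]

lemma presentedBy_noncommRow_RD (D : Matrix (Fin 3) (Fin 3) F) :
    PresentedBy (NoncommRow.RD D).algebra (fun _ : Fin 1 => D) := by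
  refine NoncommRow.presentedBy _ formCoord _ fun v w v' w' => ?_
  simp [formCoord, NoncommRow.mat, matRD, formVec, Matrix.mulVec, dotProduct, Fin.sum_univ_succ,
    vec5_zero, mul_add, add_assoc]

lemma presentedBy_U1_00 :
    PresentedBy (F := F) (CommRow.U1_00 (F := F)).algebra ![!![1, 0; 0, 0], !![0, 1; 1, 0]] := by
  refine CommRow.presentedBy _ pairCoord _ fun v w v' w' => ?_
  simp [pairCoord, CommRow.mat, formVec, vec5_zero, dotProduct, Fin.sum_univ_succ]

lemma presentedBy_U1_0 (ρ : F) :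
    PresentedBy (CommRow.U1_0 ρ).algebra ![!![1, 0; 0, ρ], !![0, 1; 1, 0]] := by
  refine CommRow.presentedBy _ pairCoord _ fun v w v' w' => ?_
  simp [pairCoord, CommRow.mat, formVec, vec5_zero, dotProduct, Fin.sum_univ_succ]

lemma presentedBy_U1_1 (ε : F) :
    PresentedBy (CommRow.U1_1 ε).algebra ![!![1, 0; 0, ε], !![0, 1; 1, 1]] := by
  refine CommRow.presentedBy _ pairCoord _ fun v w v' w' => ?_
  simp [pairCoord, CommRow.mat, formVec, vec5_zero, dotProduct, Fin.sum_univ_succ]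

lemma presentedBy_U3_010 :
    PresentedBy (F := F) (NoncommRow.U3_010 (F := F)).algebra ![!![1, 0; 0, 0], !![0, 0; 1, 0]] := by
  refine NoncommRow.presentedBy _ altPairCoord _ fun v w v' w' => ?_
  simp [altPairCoord, NoncommRow.mat, formVec, vec5_zero, dotProduct, Fin.sum_univ_succ]

lemma presentedBy_U3_011 :
    PresentedBy (F := F) (NoncommRow.U3_011 (F := F)).algebra ![!![1, 0; 0, 0], !![0, 0; 1, 1]] := by
  refine NoncommRow.presentedBy _ altPairCoord _ fun v w v' w' => ?_
  simp [altPairCoord, NoncommRow.mat, formVec, vec5_zero, dotProduct, Fin.sum_univ_succ]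

lemma presentedBy_U3_1 (l : F) :
    PresentedBy (NoncommRow.U3_1 l).algebra ![!![1, 0; 0, 0], !![0, 1; l, 0]] := by
  refine NoncommRow.presentedBy _ altPairCoord _ fun v w v' w' => ?_
  simp [altPairCoord, NoncommRow.mat, formVec, vec5_zero, dotProduct, Fin.sum_univ_succ]

lemma presentedBy_U4 (ρ β₁ β₂ : F) :
    PresentedBy (NoncommRow.U4 ρ β₁ β₂).algebra ![!![1, 0; 0, ρ], !![0, 1; β₁, β₂]] := by
  refine NoncommRow.presentedBy _ pairCoord _ fun v w v' w' => ?_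
  simp [pairCoord, NoncommRow.mat, formVec, vec5_zero, dotProduct, Fin.sum_univ_succ]

lemma presentedBy_U5_11 (ε : F) :
    PresentedBy (NoncommRow.U5_11 ε).algebra ![!![0, 1; 1, 0], !![1, 1; 0, ε]] := by
  refine NoncommRow.presentedBy _ pairCoord _ fun v w v' w' => ?_
  simp [pairCoord, NoncommRow.mat, formVec, vec5_zero, dotProduct, Fin.sum_univ_succ]

/-- A product rule for an algebra with coordinates gives isomorphisms to a row. -/
lemma CommRow.algIso_of_mul {N : Type*} [NonUnitalRing N] [Module F N] (r : CommRow F)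
    (e : (Fin 4 → F) ≃ₗ[F] N) (p : (Fin 4 → F) → (Fin 4 → F) → Fin 4 → F)
    (he : ∀ x y, e x * e y = e (p x y))
    (hr : ∀ x y, r.mat (x 0) (x 1) (x 2) (x 3) * r.mat (y 0) (y 1) (y 2) (y 3) =
      r.mat (p x y 0) (p x y 1) (p x y 2) (p x y 3)) : AlgIso F N r.algebra := by
  obtain ⟨f, hf⟩ := r.exists_coord
  refine AlgIso.symm (AlgIso.of_linearEquiv (f.symm.trans e) fun x y => ?_)
  obtain ⟨x, rfl⟩ := f.surjective x
  obtain ⟨y, rfl⟩ := f.surjective y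
  have : f x * f y = f (p x y) := Subtype.ext (by simp [hf, hr])
  simp [this, he]

lemma NoncommRow.algIso_of_mul {N : Type*} [NonUnitalRing N] [Module F N] (r : NoncommRow F)
    (e : (Fin 4 → F) ≃ₗ[F] N) (p : (Fin 4 → F) → (Fin 4 → F) → Fin 4 → F)
    (he : ∀ x y, e x * e y = e (p x y))
    (hr : ∀ x y, r.mat (x 0) (x 1) (x 2) (x 3) * r.mat (y 0) (y 1) (y 2) (y 3) =
      r.mat (p x y 0) (p x y 1) (p x y 2) (p x y 3)) : AlgIso F N r.algebra := by
  obtain ⟨f, hf⟩ := r.exists_coord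
  refine AlgIso.symm (AlgIso.of_linearEquiv (f.symm.trans e) fun x y => ?_)
  obtain ⟨x, rfl⟩ := f.surjective x
  obtain ⟨y, rfl⟩ := f.surjective y
  have : f x * f y = f (p x y) := Subtype.ext (by simp [hf, hr])
  simp [this, he]

end Rows

/-! ### The descending chain of powers. -/

section Powers

variable {F N : Type*} [Field F] [NonUnitalRing N] [Module F N]

lemma mul_mem_npow_succ {k : ℕ} {x : N} (hx : x ∈ npow F N k) (y : N) :
    x * y ∈ npow F N (k + 1) :=
  Submodule.subset_span ⟨x, hx, y, rfl⟩

lemma npow_succ_le (k : ℕ) : npow F N (k + 1) ≤ npow F N k := by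
  induction k with
  | zero => exact le_top
  | succ k ih =>
    refine Submodule.span_mono ?_
    rintro _ ⟨x, hx, y, rfl⟩
    exact ⟨x, ih hx, y, rfl⟩

lemma npow_succ_lt (hN : IsNilpotentAlgebra F N) {k : ℕ} (hk : npow F N k ≠ ⊥) :
    npow F N (k + 1) < npow F N k := by
  refine lt_of_le_of_ne (npow_succ_le k) fun h => hk ?_
  -- Once two consecutive powers coincide the chain is constant, while nilpotency makes some power
  -- zero.
  have key : ∀ l, npow F N (k + l) = npow F N k := by
    intro l
    induction l with
    | zero => rfl
    | succ l ih =>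
      rw [← h, ← Nat.add_assoc]
      unfold npow
      rw [ih]
  obtain ⟨n, hn⟩ := hN
  have hanti : npow F N (k + n) ≤ npow F N n := by
    induction k with
    | zero => simp
    | succ k _ =>
      have : ∀ i, npow F N (i + n) ≤ npow F N n := by
        intro i
        induction i with
        | zero => simp
        | succ i ih =>
          rw [Nat.add_right_comm]
          exact (npow_succ_le _).trans ih
      exact this _
  rw [← key n, eq_bot_iff, ← hn]
  exact hanti

/-- Powers are built by multiplication on the right, so a right factor is peeled off by
associativity. The extra 1 comes from the shift between index and exponent. -/
lemma mul_mem_npow [SMulCommClass F N N] {i j : ℕ} {x y : N} (hx : x ∈ npow F N i) (hy : y ∈ npow F N j) :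
    x * y ∈ npow F N (i + j + 1) := by
  induction j generalizing y with
  | zero => exact mul_mem_npow_succ hx y
  | succ j ih =>
    induction hy using Submodule.span_induction with
    | mem z hz =>
      obtain ⟨u, hu, v, rfl⟩ := hz
      rw [← mul_assoc]
      exact mul_mem_npow_succ (ih hu) v
    | zero => simp
    | add u v _ _ hu hv =>
      rw [mul_add]
      exact add_mem hu hv
    | smul a u _ hu =>
      rw [mul_smul_comm]
      exact Submodule.smul_mem _ _ hu

lemma mul_mem_npow_succ_of_right [SMulCommClass F N N] {k : ℕ} {y : N} (x : N) (hy : y ∈ npow F N k) :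
    x * y ∈ npow F N (k + 1) := by
  simpa using mul_mem_npow (i := 0) (Submodule.mem_top : x ∈ npow F N 0) hy

lemma npow_two_eq_bot_iff [IsScalarTower F N N] : npow F N 2 = ⊥ ↔ ∀ x y z : N, x * y * z = 0 := by
  constructor
  · intro h x y z
    have : x * y * z ∈ npow F N 2 :=
      mul_mem_npow_succ (mul_mem_npow_succ (Submodule.mem_top : x ∈ npow F N 0) y) z
    rwa [h, Submodule.mem_bot] at this
  · intro h
    refine Submodule.span_eq_bot.2 ?_
    rintro _ ⟨u, hu, z, rfl⟩
    induction hu using Submodule.span_induction with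
    | mem v hv =>
      obtain ⟨x, -, y, rfl⟩ := hv
      exact h x y z
    | zero => simp
    | add u v _ _ hu hv => rw [add_mul, hu, hv, add_zero]
    | smul a u _ hu => rw [smul_mul_assoc, hu, smul_zero]

/-- Modulo higher powers `(c a + u')(d x + v')` is `c d (a x)`. Iterating from `a = x`, a generator
of `N` modulo its square yields generators `x²`, `x³`, ... of the successive quotients. -/
lemma npow_succ_le_span [IsScalarTower F N N] [SMulCommClass F N N] {x : N} (hx : ∀ y : N, ∃ c : F, ∃ n ∈ npow F N 1, y = c • x + n) {k : ℕ}
    {a : N} (ha : a ∈ npow F N k)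
    (h : ∀ y ∈ npow F N k, ∃ c : F, ∃ n ∈ npow F N (k + 1), y = c • a + n) :
    ∀ y ∈ npow F N (k + 1), ∃ c : F, ∃ n ∈ npow F N (k + 2), y = c • (a * x) + n := by
  intro y hy
  induction hy using Submodule.span_induction with
  | mem z hz =>
    obtain ⟨u, hu, v, rfl⟩ := hz
    obtain ⟨c, u', hu', rfl⟩ := h u hu
    obtain ⟨d, v', hv', rfl⟩ := hx v
    refine ⟨c * d, c • (a * v') + u' * (d • x + v'),
      add_mem (Submodule.smul_mem _ _ (mul_mem_npow ha hv')) (mul_mem_npow_succ hu' _), ?_⟩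
    simp only [add_mul, mul_add, smul_mul_assoc, mul_smul_comm]
    module
  | zero => exact ⟨0, 0, zero_mem _, by simp⟩
  | add u v _ _ hu hv =>
    obtain ⟨c, n, hn, rfl⟩ := hu
    obtain ⟨d, m, hm, rfl⟩ := hv
    exact ⟨c + d, n + m, add_mem hn hm, by module⟩
  | smul b u _ hu =>
    obtain ⟨c, n, hn, rfl⟩ := hu
    exact ⟨b * c, b • n, Submodule.smul_mem _ _ hn, by module⟩

end Powers

/-! ### Bases of four-dimensional spaces. -/

section Bases

variable {F N : Type*} [Field F] [AddCommGroup N] [Module F N]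

/-- The linear map from `F ^ 4` attached to four vectors. -/
def combination (F : Type*) {N : Type*} [Field F] [AddCommGroup N] [Module F N] (a b c d : N) :
    (Fin 4 → F) →ₗ[F] N where
  toFun x := x 0 • a + x 1 • b + x 2 • c + x 3 • d
  map_add' x y := by
    simp only [Pi.add_apply]
    module
  map_smul' k x := by
    simp only [Pi.smul_apply, smul_eq_mul, RingHom.id_apply]
    module

lemma exists_equiv_of_spanning (hN : Module.finrank F N = 4) (a b c d : N)
    (h : ∀ y : N, ∃ s t u v : F, y = s • a + t • b + u • c + v • d) :
    ∃ e : (Fin 4 → F) ≃ₗ[F] N, ∀ x, e x = x 0 • a + x 1 • b + x 2 • c + x 3 • d := by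
  have : FiniteDimensional F N := Module.finite_of_finrank_pos (by omega)
  have hs : Function.Surjective (combination F a b c d) := by
    intro y
    obtain ⟨s, t, u, v, rfl⟩ := h y
    exact ⟨![s, t, u, v], by simp [combination]⟩
  have hi := (LinearMap.injective_iff_surjective_of_finrank_eq_finrank (by simp [hN])).2 hs
  exact ⟨LinearEquiv.ofBijective _ ⟨hi, hs⟩, fun x => rfl⟩

lemma exists_equiv_of_independent (hN : Module.finrank F N = 4) (a b c d : N)
    (h : ∀ s t u v : F, s • a + t • b + u • c + v • d = 0 → s = 0 ∧ t = 0 ∧ u = 0 ∧ v = 0) :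
    ∃ e : (Fin 4 → F) ≃ₗ[F] N, ∀ x, e x = x 0 • a + x 1 • b + x 2 • c + x 3 • d := by
  have : FiniteDimensional F N := Module.finite_of_finrank_pos (by omega)
  have hi : Function.Injective (combination F a b c d) := by
    rw [← LinearMap.ker_eq_bot, LinearMap.ker_eq_bot']
    intro x hx
    obtain ⟨h0, h1, h2, h3⟩ := h _ _ _ _ hx
    ext i
    fin_cases i <;> assumption
  have hs := (LinearMap.injective_iff_surjective_of_finrank_eq_finrank (by simp [hN])).1 hi
  exact ⟨LinearEquiv.ofBijective _ ⟨hi, hs⟩, fun x => rfl⟩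

/-- A subspace of codimension at most one together with a vector outside spans. -/
lemma exists_smul_add_of_finrank_le [FiniteDimensional F N] {V W : Submodule F N} (hVW : V < W)
    (h : Module.finrank F W ≤ Module.finrank F V + 1) :
    ∃ x ∈ W, x ∉ V ∧ ∀ y ∈ W, ∃ c : F, ∃ n ∈ V, y = c • x + n := by
  obtain ⟨x, hx, hxV⟩ := SetLike.exists_of_lt hVW
  refine ⟨x, hx, hxV, fun y hy => ?_⟩
  have hlt : V < F ∙ x ⊔ V := lt_of_le_of_ne le_sup_right fun heq =>
    hxV (heq ▸ Submodule.mem_sup_left (Submodule.mem_span_singleton_self x))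
  have hle : F ∙ x ⊔ V ≤ W := sup_le ((Submodule.span_singleton_le_iff_mem x W).2 hx) hVW.le
  have heq := Submodule.eq_of_le_of_finrank_le hle
    (h.trans (Submodule.finrank_lt_finrank_of_lt hlt))
  rw [← heq] at hy
  obtain ⟨u, hu, n, hn, rfl⟩ := Submodule.mem_sup.1 hy
  obtain ⟨c, rfl⟩ := Submodule.mem_span_singleton.1 hu
  exact ⟨c, n, hn, rfl⟩

end Bases

/-! ### Algebras with one generator, and generators when the cube is nonzero. -/

section Structure

variable {F N : Type*} [Field F] [NonUnitalRing N] [Module F N]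

lemma finrank_npow_succ_lt [FiniteDimensional F N] (hN : IsNilpotentAlgebra F N) {k : ℕ}
    (hk : npow F N k ≠ ⊥) :
    Module.finrank F (npow F N (k + 1)) < Module.finrank F (npow F N k) :=
  Submodule.finrank_lt_finrank_of_lt (npow_succ_lt hN hk)

lemma finrank_npow_add_le [FiniteDimensional F N] (hN : IsNilpotentAlgebra F N) (k : ℕ) :
    Module.finrank F (npow F N k) ≤ Module.finrank F N - k := by
  induction k with
  | zero => exact Submodule.finrank_le _
  | succ k ih =>
    by_cases hk : npow F N k = ⊥
    · have : npow F N (k + 1) = ⊥ := eq_bot_iff.2 ((npow_succ_le k).trans hk.le)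
      rw [this, finrank_bot]
      exact Nat.zero_le _
    · have := finrank_npow_succ_lt hN hk
      omega

variable [IsScalarTower F N N] [SMulCommClass F N N]

/-- A four-dimensional nilpotent algebra whose square has codimension one. -/
lemma algIso_S5 (hN : IsNilpotentAlgebra F N) (h4 : Module.finrank F N = 4)
    (h : 3 ≤ Module.finrank F (npow F N 1)) :
    AlgIso F N (CommRow.S5 (F := F)).algebra := by
  have : FiniteDimensional F N := Module.finite_of_finrank_pos (by omega)
  -- The dimension drops by at least one at each step, so the fifth power is zero.
  have hbot : npow F N 4 = ⊥ := by
    have := finrank_npow_add_le hN 4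
    exact Submodule.finrank_eq_zero.1 (by omega)
  have hlt : npow F N 1 < npow F N 0 := npow_succ_lt hN fun h0 => by
    have := h.trans (Submodule.finrank_mono (npow_succ_le 0))
    rw [h0, finrank_bot] at this
    omega
  obtain ⟨x, -, -, hx⟩ := exists_smul_add_of_finrank_le hlt
    ((Submodule.finrank_le _).trans (by omega))
  have hx1 : ∀ y : N, ∃ c : F, ∃ n ∈ npow F N 1, y = c • x + n := fun y => hx y trivial
  have m1 : x ∈ npow F N 0 := trivial
  have m2 := mul_mem_npow_succ m1 x
  have m3 := mul_mem_npow_succ m2 x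
  have m4 := mul_mem_npow_succ m3 x
  have m5 := mul_mem_npow_succ m4 x
  have h2 := npow_succ_le_span hx1 m1 hx
  have h3 := npow_succ_le_span hx1 m2 h2
  have h4' := npow_succ_le_span hx1 m3 h3
  obtain ⟨e, he⟩ := exists_equiv_of_spanning h4 x (x * x) (x * x * x) (x * x * x * x) (by
    intro y
    obtain ⟨a, y₁, hy₁, rfl⟩ := hx y trivial
    obtain ⟨b, y₂, hy₂, rfl⟩ := h2 y₁ hy₁
    obtain ⟨c, y₃, hy₃, rfl⟩ := h3 y₂ hy₂
    obtain ⟨d, y₄, hy₄, rfl⟩ := h4' y₃ hy₃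
    rw [show 0 + 1 + 1 + 2 = 4 from rfl, hbot, Submodule.mem_bot] at hy₄
    refine ⟨a, b, c, d, ?_⟩
    rw [hy₄]
    module)
  have h5 : x * x * x * x * x = 0 := by
    rwa [hbot, Submodule.mem_bot] at m5
  refine CommRow.algIso_of_mul _ e (fun x y => ![0, x 0 * y 0, x 0 * y 1 + x 1 * y 0,
    x 0 * y 2 + x 1 * y 1 + x 2 * y 0]) (fun u v => ?_) fun u v => ?_
  · simp only [he, add_mul, mul_add, smul_mul_assoc, mul_smul_comm, ← mul_assoc, h5, zero_mul]
    simp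
    module
  · simp [CommRow.mat, vec5_zero, add_assoc]

/-- An associative product given, on triples, by scalar functions has a nonzero cube. -/
lemma exists_cube_ne_zero_of_scalars {F N : Type*} [Field F] [NonUnitalRing N] [Module F N]
    {z : N} (hz : z ≠ 0) {b : N → N → F} {l r : N → F}
    (hleft : ∀ x y t, x * y * t = (b x y * r t) • z)
    (hright : ∀ x y t, x * (y * t) = (b y t * l x) • z)
    (hne : ¬ ∀ x y t : N, x * y * t = 0) : ∃ x : N, x * x * x ≠ 0 := by
  -- Associativity becomes a scalar identity. From `x y t ≠ 0` it shows in turn that `b t t`, `b x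
  -- t` and `b x x` are nonzero, and `x³` is `b x x * l x` times `z`.
  have hassoc : ∀ x y t, b x y * r t = b y t * l x := by
    intro x y t
    refine smul_left_injective F hz ?_
    simp only [← hleft, ← hright, mul_assoc]
  push Not at hne
  obtain ⟨x, y, t, hxyt⟩ := hne
  have hbr : b x y * r t ≠ 0 := fun h => hxyt (by rw [hleft, h, zero_smul])
  have hr0 := right_ne_zero_of_mul hbr
  have hbl : b y t * l x ≠ 0 := (hassoc x y t).symm.trans_ne hbr
  have hl0 := right_ne_zero_of_mul hbl
  have htt : b t t ≠ 0 := left_ne_zero_of_mul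
    ((hassoc y t t).symm.trans_ne (mul_ne_zero (left_ne_zero_of_mul hbl) hr0))
  have hxt : b x t ≠ 0 := left_ne_zero_of_mul
    ((hassoc x t t).trans_ne (mul_ne_zero htt hl0))
  have hxx : b x x ≠ 0 := left_ne_zero_of_mul
    ((hassoc x x t).trans_ne (mul_ne_zero hxt hl0))
  refine ⟨x, ?_⟩
  rw [hleft, hassoc]
  exact smul_ne_zero (mul_ne_zero hxx hl0) hz

/-- In a nilpotent algebra whose powers have dimensions `4, 2, 1, 0` some cube is not zero. -/
lemma exists_cube_ne_zero [FiniteDimensional F N] (h1 : Module.finrank F (npow F N 1) = 2)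
    (h2 : Module.finrank F (npow F N 2) = 1) (h3 : npow F N 3 = ⊥) :
    ∃ x : N, x * x * x ≠ 0 := by
  have hlt : npow F N 2 < npow F N 1 := lt_of_le_of_ne (npow_succ_le 1) fun h => by
    rw [h] at h2
    omega
  -- `w` spans the square modulo the cube and `z` spans the cube. Since the fourth power vanishes, a
  -- triple product only depends on the `w`-component `b` of a product and on the scalars `l`, `r`
  -- of multiplication by `w`.
  obtain ⟨w, hw, -, hw1⟩ := exists_smul_add_of_finrank_le hlt (by omega)
  obtain ⟨z, hz0, hz⟩ := finrank_eq_one_iff'.1 h2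
  have hz' : (z : N) ≠ 0 := by simpa using hz0
  have hmem : ∀ y ∈ npow F N 2, ∃ c : F, y = c • (z : N) := by
    intro y hy
    obtain ⟨c, hc⟩ := hz ⟨y, hy⟩
    exact ⟨c, (congrArg Subtype.val hc).symm⟩
  have hl : ∀ x : N, ∃ c : F, x * w = c • (z : N) := fun x =>
    hmem _ (mul_mem_npow_succ_of_right x hw)
  have hr : ∀ x : N, ∃ c : F, w * x = c • (z : N) := fun x => hmem _ (mul_mem_npow_succ hw x)
  have hb : ∀ x y : N, ∃ c : F, ∃ n ∈ npow F N 2, x * y = c • w + n := fun x y =>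
    hw1 _ (mul_mem_npow_succ (k := 0) Submodule.mem_top y)
  choose l hl using hl
  choose r hr using hr
  choose b n hn hb using hb
  have hleft : ∀ x y t, x * y * t = (b x y * r t) • (z : N) := by
    intro x y t
    have : n x y * t ∈ npow F N 3 := mul_mem_npow_succ (hn x y) t
    rw [h3, Submodule.mem_bot] at this
    rw [hb x y, add_mul, this, smul_mul_assoc, hr, add_zero, smul_smul]
  have hright : ∀ x y t, x * (y * t) = (b y t * l x) • (z : N) := by
    intro x y t
    have : x * n y t ∈ npow F N 3 := mul_mem_npow_succ_of_right x (hn y t)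
    rw [h3, Submodule.mem_bot] at this
    rw [hb y t, mul_add, this, mul_smul_comm, hl, add_zero, smul_smul]
  have hne : ¬ ∀ x y t : N, x * y * t = 0 := by
    rw [← npow_two_eq_bot_iff (F := F)]
    intro h
    rw [h] at h2
    simp at h2
  exact exists_cube_ne_zero_of_scalars hz' hleft hright hne

/-- Generators of a nilpotent algebra whose powers have dimensions `4, 2, 1, 0`. -/
lemma exists_generators (h4 : Module.finrank F N = 4) (h1 : Module.finrank F (npow F N 1) = 2)
    (h2 : Module.finrank F (npow F N 2) = 1) (h3 : npow F N 3 = ⊥) :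
    ∃ (x y : N) (a g : F), x * x * x ≠ 0 ∧ (∀ t, x * x * x * t = 0) ∧ y * x = 0 ∧
      x * y = a • (x * x * x) ∧ y * y = g • (x * x * x) ∧
      ∀ s t u v : F, s • x + t • (x * x) + u • y + v • (x * x * x) = 0 →
        s = 0 ∧ t = 0 ∧ u = 0 ∧ v = 0 := by
  have : FiniteDimensional F N := Module.finite_of_finrank_pos (by omega)
  obtain ⟨x, hx⟩ := exists_cube_ne_zero h1 h2 h3
  have m2 : x * x ∈ npow F N 1 := mul_mem_npow_succ (k := 0) Submodule.mem_top x
  have m3 : x * x * x ∈ npow F N 2 := mul_mem_npow_succ m2 x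
  have hann : ∀ t, x * x * x * t = 0 := by
    intro t
    have := mul_mem_npow_succ m3 t
    rwa [h3, Submodule.mem_bot] at this
  have hx4 : x * (x * x * x) = 0 := by rw [← mul_assoc, ← mul_assoc, hann]
  have hind : ∀ s t u : F, s • x + t • (x * x) + u • (x * x * x) = 0 →
      s = 0 ∧ t = 0 ∧ u = 0 := by
    intro s t u h
    have hs := congrArg (· * (x * x)) h
    simp only [add_mul, smul_mul_assoc, ← mul_assoc, hann, smul_zero, add_zero, zero_mul,
      smul_eq_zero, hx, or_false] at hs
    subst hs
    have ht := congrArg (· * x) h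
    simp only [add_mul, smul_mul_assoc, hann, smul_zero, add_zero, zero_mul, zero_smul, zero_add,
      smul_eq_zero, hx, or_false] at ht
    subst ht
    simpa [hx] using h
  -- `x²` and `x³` are independent, hence a basis of the two-dimensional square.
  have hsq : ∀ z ∈ npow F N 1, ∃ s t : F, z = s • (x * x) + t • (x * x * x) := by
    let f : F × F →ₗ[F] npow F N 1 :=
      (LinearMap.toSpanSingleton F _ ⟨_, m2⟩).coprod
        (LinearMap.toSpanSingleton F _ ⟨_, npow_succ_le _ m3⟩)
    have hf : ∀ s t, (f (s, t) : N) = s • (x * x) + t • (x * x * x) := fun s t => by simp [f]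
    have hi : Function.Injective f := by
      rw [← LinearMap.ker_eq_bot, LinearMap.ker_eq_bot']
      rintro ⟨s, t⟩ hst
      have := congrArg Subtype.val hst
      rw [hf] at this
      obtain ⟨-, rfl, rfl⟩ := hind 0 s t (by simpa using this)
      rfl
    have hs := (LinearMap.injective_iff_surjective_of_finrank_eq_finrank (by simp [h1])).1 hi
    intro z hz
    obtain ⟨⟨s, t⟩, hst⟩ := hs ⟨z, hz⟩
    exact ⟨s, t, by rw [← hf, hst]⟩
  obtain ⟨y, hy⟩ : ∃ y : N, y ∉ Submodule.span F (Set.range ![x, x * x, x * x * x]) := by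
    by_contra! h
    have htop : Submodule.span F (Set.range ![x, x * x, x * x * x]) = ⊤ :=
      eq_top_iff.2 fun y _ => h y
    have := finrank_range_le_card (R := F) ![x, x * x, x * x * x]
    rw [Set.finrank, htop, finrank_top, h4] at this
    simp at this
  obtain ⟨c, d, hcd⟩ := hsq (y * x) (mul_mem_npow_succ (k := 0) Submodule.mem_top x)
  have hy' : ∀ s t u : F, y ≠ s • x + t • (x * x) + u • (x * x * x) := by
    rintro s t u rfl
    refine hy ?_
    have h0 : x ∈ Submodule.span F (Set.range ![x, x * x, x * x * x]) :=
      Submodule.subset_span ⟨0, rfl⟩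
    have h1 : x * x ∈ Submodule.span F (Set.range ![x, x * x, x * x * x]) :=
      Submodule.subset_span ⟨1, rfl⟩
    have h2 : x * x * x ∈ Submodule.span F (Set.range ![x, x * x, x * x * x]) :=
      Submodule.subset_span ⟨2, rfl⟩
    exact add_mem (add_mem (Submodule.smul_mem _ _ h0) (Submodule.smul_mem _ _ h1))
      (Submodule.smul_mem _ _ h2)
  -- As `y x = c x² + d x³`, subtracting `c x + d x²` from `y` kills the product with `x` on the
  -- right.
  obtain ⟨y₁, hy₁⟩ : ∃ y₁, y₁ = y - c • x - d • (x * x) := ⟨_, rfl⟩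
  have hyx : y₁ * x = 0 := by
    rw [hy₁, sub_mul, sub_mul, smul_mul_assoc, smul_mul_assoc, hcd]
    module
  obtain ⟨a', a, ha⟩ := hsq (x * y₁) (mul_mem_npow_succ (k := 0) Submodule.mem_top y₁)
  obtain ⟨g', g, hg⟩ := hsq (y₁ * y₁) (mul_mem_npow_succ (k := 0) Submodule.mem_top y₁)
  -- `(x y₁) x = x (y₁ x) = 0`, while multiplying `a' x² + a x³` by `x` gives `a' x³`. The same
  -- argument works for `y₁²`.
  have ha' : a' = 0 := by
    have : x * y₁ * x = 0 := by rw [mul_assoc, hyx, mul_zero]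
    rw [ha, add_mul, smul_mul_assoc, smul_mul_assoc, hann, smul_zero, add_zero] at this
    simpa [hx] using this
  have hg' : g' = 0 := by
    have : y₁ * y₁ * x = 0 := by rw [mul_assoc, hyx, mul_zero]
    rw [hg, add_mul, smul_mul_assoc, smul_mul_assoc, hann, smul_zero, add_zero] at this
    simpa [hx] using this
  refine ⟨x, y₁, a, g, hx, hann, hyx, by simpa [ha'] using ha, by simpa [hg'] using hg, ?_⟩
  intro s t u v h
  have hu : u = 0 := by
    by_contra hu
    refine hy' (c - s / u) (d - t / u) (- v / u) ?_
    have h' : u⁻¹ • (s • x + t • (x * x) + u • y₁ + v • (x * x * x)) = 0 := by rw [h, smul_zero]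
    have : y = y - u⁻¹ • (s • x + t • (x * x) + u • y₁ + v • (x * x * x)) := by
      rw [h', sub_zero]
    rw [this, hy₁]
    match_scalars <;> field_simp <;> ring
  subst hu
  obtain ⟨h1, h2, h3⟩ := hind s t v (by simpa using h)
  exact ⟨h1, h2, rfl, h3⟩

end Structure

/-! ### Normalization when the cube is nonzero, and reduction to forms. -/

section Reduction

variable {F N : Type*} [Field F] [NonUnitalRing N] [Module F N] [IsScalarTower F N N]
  [SMulCommClass F N N]

/-- The two scalars suffice to bring every nonzero one among `a`, `g` to 1. -/
lemma exists_scaled_generators {x y : N} {a g : F} (s u : F) (hs : s ≠ 0) (hu : u ≠ 0)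
    (hx : x * x * x ≠ 0) (hann : ∀ t, x * x * x * t = 0) (hyx : y * x = 0)
    (hxy : x * y = a • (x * x * x)) (hyy : y * y = g • (x * x * x))
    (hind : ∀ s t u v : F, s • x + t • (x * x) + u • y + v • (x * x * x) = 0 →
        s = 0 ∧ t = 0 ∧ u = 0 ∧ v = 0) :
    ∃ x y : N, x * x * x ≠ 0 ∧ (∀ t, x * x * x * t = 0) ∧ y * x = 0 ∧
      x * y = (a * u / s ^ 2) • (x * x * x) ∧ y * y = (g * u ^ 2 / s ^ 3) • (x * x * x) ∧
      ∀ s t u v : F, s • x + t • (x * x) + u • y + v • (x * x * x) = 0 →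
        s = 0 ∧ t = 0 ∧ u = 0 ∧ v = 0 := by
  refine ⟨s • x, u • y, ?_, fun t => ?_, ?_, ?_, ?_, fun b c d e h => ?_⟩
  · simp [smul_mul_assoc, mul_smul_comm, hs, hx]
  · simp [smul_mul_assoc, mul_smul_comm, hann]
  · simp [smul_mul_assoc, mul_smul_comm, hyx]
  · simp only [smul_mul_assoc, mul_smul_comm, hxy, smul_smul]
    congr 1
    field_simp
  · simp only [smul_mul_assoc, mul_smul_comm, hyy, smul_smul]
    congr 1
    field_simp
  · simp only [smul_mul_assoc, mul_smul_comm, smul_smul] at h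
    simpa [hs, hu] using hind _ _ _ _ h

/-- The third coordinate belongs to `y` and the fourth to `x³`. All products of `y` with `x²` or
`x³` vanish, because `y x = 0` and `x (x y)` is a multiple of `x⁴ = 0`. -/
lemma exists_coord_of_generators (h4 : Module.finrank F N = 4) {x y : N} {a g : F}
    (hann : ∀ t, x * x * x * t = 0) (hyx : y * x = 0)
    (hxy : x * y = a • (x * x * x)) (hyy : y * y = g • (x * x * x))
    (hind : ∀ s t u v : F, s • x + t • (x * x) + u • y + v • (x * x * x) = 0 →
        s = 0 ∧ t = 0 ∧ u = 0 ∧ v = 0) :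
    ∃ e : (Fin 4 → F) ≃ₗ[F] N, ∀ v w, e v * e w = e ![0, v 0 * w 0, 0,
      v 0 * w 1 + v 1 * w 0 + a * (v 0 * w 2) + g * (v 2 * w 2)] := by
  obtain ⟨e, he⟩ := exists_equiv_of_independent h4 x (x * x) y (x * x * x) hind
  refine ⟨e, fun v w => ?_⟩
  have hxxy : x * x * y = 0 := by
    rw [mul_assoc, hxy, mul_smul_comm, ← mul_assoc, ← mul_assoc, hann, smul_zero]
  have hyxx : y * (x * x) = 0 := by rw [← mul_assoc, hyx, zero_mul]
  have hyxxx : y * (x * x * x) = 0 := by rw [← mul_assoc, hyxx, zero_mul]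
  have hx4 : x * (x * x * x) = 0 := by rw [← mul_assoc, ← mul_assoc, hann]
  have hx5 : x * x * (x * x * x) = 0 := by rw [mul_assoc, hx4, mul_zero]
  have hx4' : x * x * (x * x) = 0 := by rw [← mul_assoc, hann]
  simp only [he, add_mul, mul_add, smul_mul_assoc, mul_smul_comm, hann, hyx, hxy, hyy, hxxy, hyxx,
    hyxxx, hx4, hx5, hx4', ← mul_assoc x x x, smul_zero]
  simp
  module

/-- The four-dimensional nilpotent algebras whose powers have dimensions `4, 2, 1, 0`. -/
lemma algIso_of_finrank_npow_two (h4 : Module.finrank F N = 4)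
    (h1 : Module.finrank F (npow F N 1) = 2) (h2 : Module.finrank F (npow F N 2) = 1)
    (h3 : npow F N 3 = ⊥) :
    AlgIso F N (CommRow.S41 (F := F)).algebra ∨ AlgIso F N (CommRow.S32sharp (F := F)).algebra ∨
      AlgIso F N (NoncommRow.U2_01011 (F := F)).algebra ∨
        AlgIso F N (NoncommRow.U2_01001 (F := F)).algebra := by
  obtain ⟨x, y, a, g, hx, hann, hyx, hxy, hyy, hind⟩ := exists_generators h4 h1 h2 h3
  by_cases ha : a = 0 <;> by_cases hg : g = 0
  · left
    subst ha hg
    obtain ⟨e, he⟩ := exists_coord_of_generators h4 hann hyx hxy hyy hind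
    -- In `S41` the third coordinate is that of `x³` and the fourth that of the annihilating
    -- generator.
    let σ : (Fin 4 → F) ≃ₗ[F] (Fin 4 → F) := LinearEquiv.funCongrLeft F F (Equiv.swap 2 3)
    refine CommRow.algIso_of_mul _ (σ.trans e)
      (fun v w => ![0, v 0 * w 0, v 0 * w 1 + v 1 * w 0, 0]) (fun v w => ?_) fun v w => ?_
    · rw [LinearEquiv.trans_apply, LinearEquiv.trans_apply, he, LinearEquiv.trans_apply]
      congr 1
      ext i
      fin_cases i <;> simp [σ, LinearEquiv.funCongrLeft, LinearMap.funLeft, Equiv.swap_apply_def]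
    · simp [CommRow.mat, vec5_zero]
  · right; left
    obtain ⟨x, y, hx, hann, hyx, hxy, hyy, hind⟩ :=
      exists_scaled_generators g g hg hg hx hann hyx hxy hyy hind
    obtain ⟨e, he⟩ := exists_coord_of_generators h4 hann hyx hxy hyy hind
    refine CommRow.algIso_of_mul _ e _ he fun v w => ?_
    have : g * g ^ 2 / g ^ 3 = 1 := by field_simp
    simp [CommRow.mat, vec5_zero, ha, this]
    ring
  · right; right; right
    obtain ⟨x, y, hx, hann, hyx, hxy, hyy, hind⟩ :=
      exists_scaled_generators 1 a⁻¹ one_ne_zero (inv_ne_zero ha) hx hann hyx hxy hyy hind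
    obtain ⟨e, he⟩ := exists_coord_of_generators h4 hann hyx hxy hyy hind
    refine NoncommRow.algIso_of_mul _ e _ he fun v w => ?_
    simp [NoncommRow.mat, vec5_zero, hg, ha]
    ring
  · right; right; left
    obtain ⟨x, y, hx, hann, hyx, hxy, hyy, hind⟩ :=
      -- These values of `s`, `u` solve `a u = s²` and `g u² = s³`.
      exists_scaled_generators (a ^ 2 / g) (a ^ 3 / g ^ 2) (by positivity) (by positivity)
        hx hann hyx hxy hyy hind
    obtain ⟨e, he⟩ := exists_coord_of_generators h4 hann hyx hxy hyy hind
    refine NoncommRow.algIso_of_mul _ e _ he fun v w => ?_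
    have h1 : a * (a ^ 3 / g ^ 2) / (a ^ 2 / g) ^ 2 = 1 := by field_simp
    have h2 : g * (a ^ 3 / g ^ 2) ^ 2 / (a ^ 2 / g) ^ 3 = 1 := by field_simp
    simp [NoncommRow.mat, vec5_zero, h1, h2]
    ring

/-- A subspace containing all products and annihilated by all multiplications gives a
presentation. -/
lemma exists_presentedBy [FiniteDimensional F N] {m n : ℕ} (W : Submodule F N)
    (hm : Module.finrank F W = m) (hn : Module.finrank F N = n + m)
    (hmul : ∀ x y : N, x * y ∈ W) (hl : ∀ x ∈ W, ∀ y : N, x * y = 0)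
    (hr : ∀ x : N, ∀ y ∈ W, x * y = 0) :
    ∃ S : Fin m → Matrix (Fin n) (Fin n) F, PresentedBy N S ∧
      (W = npow F N 1 → FormsIndep S) := by
  obtain ⟨V, hV⟩ := Submodule.exists_isCompl W
  have hVn : Module.finrank F V = n := by
    have := Submodule.finrank_add_eq_of_isCompl hV
    omega
  let v : V ≃ₗ[F] (Fin n → F) := LinearEquiv.ofFinrankEq _ _ (by simp [hVn])
  let w : W ≃ₗ[F] (Fin m → F) := LinearEquiv.ofFinrankEq _ _ (by simp [hm])
  let f : N ≃ₗ[F] (Fin n → F) × (Fin m → F) :=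
    (Submodule.prodEquivOfIsCompl V W hV.symm).symm.trans (v.prodCongr w)
  have hfs : ∀ a b, f.symm (a, b) = (v.symm a : N) + (w.symm b : N) := fun a b => rfl
  have hfW : ∀ x (hx : x ∈ W), f x = (0, w ⟨x, hx⟩) := by
    intro x hx
    apply f.symm.injective
    rw [LinearEquiv.symm_apply_apply, hfs]
    simp
  -- The components in `W` annihilate everything, so the product only depends on the components in
  -- the complement `V`.
  have hfmul : ∀ x y, x * y = f.symm ((f x).1, 0) * f.symm ((f y).1, 0) := by
    intro x y
    obtain ⟨⟨a, b⟩, rfl⟩ := f.symm.surjective x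
    obtain ⟨⟨c, d⟩, rfl⟩ := f.symm.surjective y
    rw [LinearEquiv.apply_symm_apply, LinearEquiv.apply_symm_apply]
    simp only [hfs, map_zero, ZeroMemClass.coe_zero, add_zero, add_mul, mul_add]
    rw [hr _ _ (w.symm d).2, hl _ (w.symm b).2, hl _ (w.symm b).2]
    simp
  let S : Fin m → Matrix (Fin n) (Fin n) F := fun k => Matrix.of fun i j =>
    (f (f.symm (Pi.single i 1, 0) * f.symm (Pi.single j 1, 0))).2 k
  have hS : ∀ a c : Fin n → F, (f (f.symm (a, 0) * f.symm (c, 0))).2 = formVec S a c := by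
    intro a c
    let B : (Fin n → F) →ₗ[F] (Fin n → F) →ₗ[F] (Fin m → F) :=
      LinearMap.mk₂ F (fun a c => (f (f.symm (a, 0) * f.symm (c, 0))).2)
        (fun a a' c => by simp [hfs, add_mul]) (fun s a c => by simp [hfs, smul_mul_assoc])
        (fun a c c' => by simp [hfs, mul_add]) (fun s a c => by simp [hfs, mul_smul_comm])
    have hB : ∀ a c, B a c = (f (f.symm (a, 0) * f.symm (c, 0))).2 := fun a c => rfl
    rw [← hB]
    conv_lhs => rw [← Finset.univ_sum_single a, ← Finset.univ_sum_single c]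
    ext k
    simp only [map_sum, LinearMap.sum_apply, Finset.sum_apply, formVec, dotProduct, Matrix.mulVec,
      Finset.mul_sum]
    rw [Finset.sum_comm]
    refine Finset.sum_congr rfl fun i _ => Finset.sum_congr rfl fun j _ => ?_
    have hi : Pi.single i (a i) = a i • (Pi.single i 1 : Fin n → F) := by
      rw [← Pi.single_smul, smul_eq_mul, mul_one]
    have hj : Pi.single j (c j) = c j • (Pi.single j 1 : Fin n → F) := by
      rw [← Pi.single_smul, smul_eq_mul, mul_one]
    rw [hi, hj, map_smul, map_smul, LinearMap.smul_apply, hB]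
    simp [S]
    ring
  have hf : ∀ x y, f (x * y) = (0, formVec S (f x).1 (f y).1) := by
    intro x y
    rw [← hS, ← hfmul]
    exact Prod.ext (by rw [hfW _ (hmul x y)]) rfl
  refine ⟨S, ⟨f, hf⟩, ?_⟩
  rintro rfl c hc
  -- A linear relation between the forms is a functional on `W` that vanishes on all products; it is
  -- zero when the products span `W`.
  have key : ∀ x ∈ npow F N 1, c ⬝ᵥ (f x).2 = 0 := by
    intro x hx
    induction hx using Submodule.span_induction with
    | mem z hz =>
      obtain ⟨x, -, y, rfl⟩ := hz
      rw [hf, dotProduct_formVec, hc]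
      simp
    | zero => simp
    | add x y _ _ hx hy => simp [hx, hy]
    | smul a x _ hx => simp [hx]
  ext k
  have := key (w.symm (Pi.single k 1)) (w.symm _).2
  rw [hfW _ (w.symm _).2] at this
  simpa using this

end Reduction

/-! ### Pairs of binary forms in coordinates. -/

section Pairs

variable {F : Type*} [Field F]

lemma congruence_two (x y z w a b c d : F) :
    !![x, y; z, w] * !![a, b; c, d] * (!![x, y; z, w] : Matrix (Fin 2) (Fin 2) F).transpose =
      !![a * x * x + b * x * y + c * y * x + d * y * y,
          a * x * z + b * x * w + c * y * z + d * y * w;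
         a * z * x + b * z * y + c * w * x + d * w * y,
          a * z * z + b * z * w + c * w * z + d * w * w] := by
  ext i j
  fin_cases i <;> fin_cases j <;> simp [Matrix.mul_apply, Fin.sum_univ_two] <;> ring

lemma formsSim_pair_iff {S T S' T' : Matrix (Fin 2) (Fin 2) F} :
    FormsSim ![S, T] ![S', T'] ↔ ∃ (P : Matrix (Fin 2) (Fin 2) F) (a b c d : F),
      P.det ≠ 0 ∧ a * d - b * c ≠ 0 ∧ P * S * P.transpose = a • S' + b • T' ∧
        P * T * P.transpose = c • S' + d • T' := by
  constructor
  · rintro ⟨P, Q, hP, hQ, h⟩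
    have h0 := h 0
    have h1 := h 1
    rw [Matrix.isUnit_iff_isUnit_det, isUnit_iff_ne_zero] at hP hQ
    rw [Matrix.det_fin_two] at hQ
    exact ⟨P, Q 0 0, Q 0 1, Q 1 0, Q 1 1, hP, hQ, by simpa [Fin.sum_univ_two] using h0,
      by simpa [Fin.sum_univ_two] using h1⟩
  · rintro ⟨P, a, b, c, d, hP, hQ, h0, h1⟩
    refine ⟨P, !![a, b; c, d], ?_, ?_, fun k => ?_⟩
    · rwa [Matrix.isUnit_iff_isUnit_det, isUnit_iff_ne_zero]
    · rwa [Matrix.isUnit_iff_isUnit_det, isUnit_iff_ne_zero, Matrix.det_fin_two_of]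
    · fin_cases k
      · simpa [Fin.sum_univ_two] using h0
      · simpa [Fin.sum_univ_two] using h1

/-- Similarity of pairs of binary forms, in terms of the entries. -/
lemma formsSim_pair_entries {s₁ s₂ s₃ s₄ t₁ t₂ t₃ t₄ s₁' s₂' s₃' s₄' t₁' t₂' t₃' t₄' : F} :
    FormsSim ![!![s₁, s₂; s₃, s₄], !![t₁, t₂; t₃, t₄]]
        ![!![s₁', s₂'; s₃', s₄'], !![t₁', t₂'; t₃', t₄']] ↔
      ∃ x y z w a b c d : F, x * w - y * z ≠ 0 ∧ a * d - b * c ≠ 0 ∧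
        (s₁ * x * x + s₂ * x * y + s₃ * y * x + s₄ * y * y = a * s₁' + b * t₁' ∧
          s₁ * x * z + s₂ * x * w + s₃ * y * z + s₄ * y * w = a * s₂' + b * t₂' ∧
          s₁ * z * x + s₂ * z * y + s₃ * w * x + s₄ * w * y = a * s₃' + b * t₃' ∧
          s₁ * z * z + s₂ * z * w + s₃ * w * z + s₄ * w * w = a * s₄' + b * t₄') ∧
        t₁ * x * x + t₂ * x * y + t₃ * y * x + t₄ * y * y = c * s₁' + d * t₁' ∧
          t₁ * x * z + t₂ * x * w + t₃ * y * z + t₄ * y * w = c * s₂' + d * t₂' ∧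
          t₁ * z * x + t₂ * z * y + t₃ * w * x + t₄ * w * y = c * s₃' + d * t₃' ∧
          t₁ * z * z + t₂ * z * w + t₃ * w * z + t₄ * w * w = c * s₄' + d * t₄' := by
  rw [formsSim_pair_iff]
  constructor
  · rintro ⟨P, a, b, c, d, hP, hQ, h0, h1⟩
    rw [Matrix.eta_fin_two P] at hP h0 h1
    rw [Matrix.det_fin_two_of] at hP
    rw [congruence_two] at h0 h1
    refine ⟨_, _, _, _, a, b, c, d, hP, hQ, ?_, ?_⟩
    · simpa [and_assoc] using h0
    · simpa [and_assoc] using h1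
  · rintro ⟨x, y, z, w, a, b, c, d, hP, hQ, h0, h1⟩
    refine ⟨!![x, y; z, w], a, b, c, d, by rwa [Matrix.det_fin_two_of], hQ, ?_, ?_⟩
    · rw [congruence_two]
      simpa [and_assoc] using h0
    · rw [congruence_two]
      simpa [and_assoc] using h1

lemma formsIndep_pair {S T : Matrix (Fin 2) (Fin 2) F} :
    FormsIndep ![S, T] ↔ ∀ a b : F, a • S + b • T = 0 → a = 0 ∧ b = 0 := by
  constructor
  · intro h a b hab
    have := h ![a, b] (by simpa [Fin.sum_univ_two] using hab)
    exact ⟨congrFun this 0, congrFun this 1⟩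
  · intro h c hc
    obtain ⟨h0, h1⟩ := h (c 0) (c 1) (by simpa [Fin.sum_univ_two] using hc)
    ext k
    fin_cases k <;> assumption

lemma formsIndep_pair_entries {s₁ s₂ s₃ s₄ t₁ t₂ t₃ t₄ : F} :
    FormsIndep ![!![s₁, s₂; s₃, s₄], !![t₁, t₂; t₃, t₄]] ↔
      ∀ a b : F, a * s₁ + b * t₁ = 0 → a * s₂ + b * t₂ = 0 → a * s₃ + b * t₃ = 0 →
        a * s₄ + b * t₄ = 0 → a = 0 ∧ b = 0 := by
  rw [formsIndep_pair]
  refine forall_congr' fun a => forall_congr' fun b => ?_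
  rw [show (0 : Matrix (Fin 2) (Fin 2) F) = !![0, 0; 0, 0] by
    ext i j
    fin_cases i <;> fin_cases j <;> rfl]
  simp

end Pairs

/-! ### Pairs of symmetric binary forms. -/

section Symmetric

variable {F N : Type*} [Field F] [NonUnitalRing N] [Module F N]

/-- Commutative algebras generated by `e₁, e₂` with `e₁²`, `e₁ e₂` a basis of the square and
`e₂² = ρ e₁² + a e₁ e₂`. -/
def commPair (a ρ : F) : Fin 2 → Matrix (Fin 2) (Fin 2) F := ![!![1, 0; 0, ρ], !![0, 1; 1, a]]

lemma formsIndep_commPair (a ρ : F) : FormsIndep (commPair a ρ) := by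
  unfold commPair
  rw [formsIndep_pair_entries]
  intro b c h1 h2 _ _
  exact ⟨by simpa using h1, by simpa using h2⟩

/-- The minor is nonzero exactly when `e₁²` and `e₁e₂` are independent, hence a basis of the target.
The constants express `e₂²` in it by Cramer's rule. -/
lemma exists_commPair_of_minor {p q r p' q' r' : F}
    (h : PresentedBy N ![!![p, q; q, r], !![p', q'; q', r']]) (hC : p * q' - q * p' ≠ 0) :
    ∃ a ρ : F, PresentedBy N (commPair a ρ) := by
  obtain ⟨D, hD⟩ : ∃ D, D = p * q' - q * p' := ⟨_, rfl⟩
  have hD0 : D ≠ 0 := hD ▸ hC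
  refine ⟨-(r * p' - p * r') / D, -(q * r' - r * q') / D, h.of_formsSim (formsSim_pair_entries.2 ⟨1, 0, 0, 1, p, q, p', q', by simp, hC, ?_, ?_⟩)⟩
  · refine ⟨by ring, by ring, by ring, ?_⟩
    field_simp
    rw [hD]
    ring
  · refine ⟨by ring, by ring, by ring, ?_⟩
    field_simp
    rw [hD]
    ring

/-- Independence means that some 2×2 minor of the coefficient array `(p, q, r; p', q', r')` is
nonzero. Exchanging `e₁` and `e₂`, or replacing `e₁` by `e₁ + e₂`, moves this minor to the first
place. -/
lemma exists_commPair {p q r p' q' r' : F}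
    (h : PresentedBy N ![!![p, q; q, r], !![p', q'; q', r']])
    (hi : FormsIndep ![!![p, q; q, r], !![p', q'; q', r']]) :
    ∃ a ρ : F, PresentedBy N (commPair a ρ) := by
  by_cases hC : p * q' - q * p' = 0
  swap
  · exact exists_commPair_of_minor h hC
  by_cases hA : q * r' - r * q' = 0
  swap
  · refine exists_commPair_of_minor (p := r) (q := q) (r := p) (p' := r') (q' := q') (r' := p')
      (h.of_formsSim (formsSim_pair_entries.2 ⟨0, 1, 1, 0, 1, 0, 0, 1, by simp, by simp,
        by simp, by simp⟩)) fun h0 => hA (by linear_combination -h0)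
  by_cases hB : r * p' - p * r' = 0
  swap
  · refine exists_commPair_of_minor (p := p + 2 * q + r) (q := q + r) (r := r)
      (p' := p' + 2 * q' + r') (q' := q' + r') (r' := r')
      (h.of_formsSim (formsSim_pair_entries.2 ⟨1, 1, 0, 1, 1, 0, 0, 1, by simp, by simp, ?_, ?_⟩))
      fun h0 => hB (by linear_combination -h0 + hC + hA)
    · refine ⟨?_, ?_, ?_, ?_⟩ <;> ring
    · refine ⟨?_, ?_, ?_, ?_⟩ <;> ring
  rw [formsIndep_pair_entries] at hi
  -- With all minors zero, `(p', -p)` is a linear relation between the two forms, and similarly for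
  -- `q` and `r`.
  have hp : p = 0 := by
    have := (hi p' (-p) (by ring) (by linear_combination -hC) (by linear_combination -hC)
      (by linear_combination hB)).2
    simpa using this
  have hq : q = 0 := by
    have := (hi q' (-q) (by linear_combination hC) (by ring) (by ring)
      (by linear_combination -hA)).2
    simpa using this
  have hr : r = 0 := by
    have := (hi r' (-r) (by linear_combination -hB) (by linear_combination hA)
      (by linear_combination hA) (by ring)).2
    simpa using this
  subst hp hq hr
  exact absurd (hi 1 0 (by simp) (by simp) (by simp) (by simp)).1 one_ne_zero

/-- The base change `e₂ ↦ z e₁ + w e₂`. -/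
lemma PresentedBy.commPair_change {a ρ : F} (h : PresentedBy N (commPair a ρ)) (z : F) {w : F}
    (hw : w ≠ 0) : PresentedBy N (commPair (2 * z + a * w) (ρ * w ^ 2 - z ^ 2 - a * z * w)) := by
  refine h.of_formsSim (formsSim_pair_entries.2 ⟨1, 0, z, w, 1, z, 0, w, by simpa, by simpa, ?_, ?_⟩)
  · refine ⟨?_, ?_, ?_, ?_⟩ <;> ring
  · refine ⟨?_, ?_, ?_, ?_⟩ <;> ring

/-- In characteristic two `(x e₁ + y e₂)² = (x² + ρ y²) e₁²`, so all squares lie on one line. The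
new basis is `x₃ e₁ + x₄ e₂`, `x₁ e₁ + x₂ e₂`, and `σ` is the ratio of the two squares. -/
lemma PresentedBy.commPair_of_starRel (h2 : (2 : F) = 0) {ρ σ : F}
    (h : PresentedBy N (commPair 0 ρ)) (hρ : StarRel F ρ σ) : PresentedBy N (commPair 0 σ) := by
  obtain ⟨x₁, x₂, x₃, x₄, hd, hn, rfl⟩ := hρ
  have hd' : x₃ * x₂ - x₄ * x₁ ≠ 0 := fun h0 => hd (by linear_combination -h0)
  obtain ⟨D, hD⟩ : ∃ D, D = x₃ ^ 2 + x₄ ^ 2 * ρ := ⟨_, rfl⟩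
  rw [← hD] at hn ⊢
  refine h.of_formsSim (formsSim_pair_entries.2 ⟨x₃, x₄, x₁, x₂, D,
    x₁ * x₃ + ρ * x₂ * x₄, 0, x₃ * x₂ - x₄ * x₁, hd', ?_, ?_, ?_⟩)
  · simpa using ⟨hn, hd'⟩
  · refine ⟨by rw [hD]; ring, by ring, by ring, ?_⟩
    field_simp
    ring
  · refine ⟨?_, ?_, ?_, ?_⟩
    · linear_combination x₃ * x₄ * h2
    · linear_combination x₄ * x₁ * h2
    · linear_combination x₄ * x₁ * h2
    · linear_combination x₁ * x₂ * h2

/-- Presentations of the same algebra by two pairs in normal form. -/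
lemma commPair_relation {a ρ a' ρ' : F} (h : PresentedBy N (commPair a ρ))
    (h' : PresentedBy N (commPair a' ρ')) :
    ∃ x y z w : F, x * w - y * z ≠ 0 ∧
      z ^ 2 + ρ' * w ^ 2 = ρ * (x ^ 2 + ρ' * y ^ 2) + a * (x * z + ρ' * y * w) ∧
      2 * z * w + a' * w ^ 2 =
        ρ * (2 * x * y + a' * y ^ 2) + a * (x * w + y * z + a' * y * w) := by
  obtain ⟨x, y, z, w, b, c, d, e, hP, -, ⟨h1, h2, -, h3⟩, h4, h5, -, h6⟩ :=
    formsSim_pair_entries.1 (h.formsSim (formsIndep_commPair a ρ) h')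
  refine ⟨x, y, z, w, hP, ?_, ?_⟩
  · linear_combination h3 - ρ * h1 - a * h2
  · linear_combination h6 - ρ * h4 - a * h5

/-- The determinant of `s S + t T` is `ρ s² - t²`, whose discriminant is invariant up to squares;
`key` is the explicit form of this invariance. -/
lemma sqClass_of_commPair (h2 : (2 : F) ≠ 0) {ρ ρ' : F} (h : PresentedBy N (commPair 0 ρ))
    (h' : PresentedBy N (commPair 0 ρ')) : SqClass F ρ ρ' := by
  obtain ⟨x, y, z, w, hd, h1, h3⟩ := commPair_relation h h'
  have h3' : z * w = ρ * x * y := by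
    apply mul_left_cancel₀ h2
    linear_combination h3
  have key : ρ * (x * w - y * z) ^ 2 = ρ' * (w ^ 2 - ρ * y ^ 2) ^ 2 := by
    linear_combination (-(w ^ 2 - ρ * y ^ 2)) * h1 + (z * w + ρ * x * y - 2 * ρ * x * y) * h3'
  have hne : w ^ 2 - ρ * y ^ 2 ≠ 0 := by
    intro h0
    rw [h0] at key
    have hρ : ρ = 0 := by simpa [hd] using key
    subst hρ
    have hw : w = 0 := by simpa using h0
    subst hw
    have hz : z = 0 := by simpa using h1
    subst hz
    simp at hd
  refine ⟨(w ^ 2 - ρ * y ^ 2) / (x * w - y * z), div_ne_zero hne hd, ?_⟩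
  rw [div_pow, div_mul_eq_mul_div, eq_div_iff (pow_ne_zero 2 hd)]
  linear_combination key

/-- As all squares lie on one line, `ρ` is the ratio of the squares of two basis vectors. The
denominator is nonzero, since otherwise both squares vanish and in characteristic two the
determinant does too. -/
lemma starRel_of_commPair (h2 : (2 : F) = 0) {ρ ρ' : F} (h : PresentedBy N (commPair 0 ρ))
    (h' : PresentedBy N (commPair 0 ρ')) : StarRel F ρ' ρ := by
  obtain ⟨x, y, z, w, hd, h1, -⟩ := commPair_relation h h'
  have hne : x ^ 2 + y ^ 2 * ρ' ≠ 0 := by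
    intro h0
    have h3 : z ^ 2 + ρ' * w ^ 2 = 0 := by linear_combination h1 + ρ * h0
    have : (x * w - y * z) ^ 2 = 0 := by
      linear_combination w ^ 2 * h0 + y ^ 2 * h3 - (x * y * z * w + ρ' * y ^ 2 * w ^ 2) * h2
    exact hd (pow_eq_zero_iff two_ne_zero |>.1 this)
  refine ⟨z, w, x, y, fun h0 => hd (by linear_combination -h0), hne, ?_⟩
  rw [eq_div_iff hne]
  linear_combination -h1

/-- In characteristic two the squares lie on a line if `a = 0` but not if `a = 1`; here the second
relation reduces to the vanishing of the determinant. -/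
lemma not_commPair_zero_one (h2 : (2 : F) = 0) {ε ρ : F} (h : PresentedBy N (commPair 1 ε))
    (h' : PresentedBy N (commPair 0 ρ)) : False := by
  obtain ⟨x, y, z, w, hd, -, h3⟩ := commPair_relation h h'
  exact hd (by linear_combination -h3 + (z * w - ε * x * y - y * z) * h2)

/-- Comparison of Artin-Schreier classes through norm forms. -/
lemma artinSchreierClass_of_norm (h2 : (2 : F) = 0) {x y z w c ε η : F} (hc : c ≠ 0)
    (h1 : c = x ^ 2 + x * y + η * y ^ 2) (h3 : c = x * w + y * z)
    (h4 : c * ε = z ^ 2 + z * w + η * w ^ 2) : ArtinSchreierClass F ε η := by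
  refine ⟨(z * x + z * y + η * w * y) / c, ?_⟩
  -- Multiplicativity of the norm from `F[θ]`, `θ² = θ + η`: the left side is the norm of `(z + wθ)`
  -- times the conjugate of `x + yθ`, whose `θ`-coefficient is `c`. Dividing by `c²` compares `ε`
  -- with `η`.
  have key : (z * x + z * y + η * w * y) ^ 2 + (z * x + z * y + η * w * y) * c + η * c ^ 2 =
      (x ^ 2 + x * y + η * y ^ 2) * (z ^ 2 + z * w + η * w ^ 2) := by
    rw [h3]
    linear_combination (y ^ 2 * z ^ 2 + x * y * z ^ 2 + 2 * η * x * y * z * w +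
      η * y ^ 2 * z * w) * h2
  rw [← h1, ← h4] at key
  field_simp
  linear_combination -key

lemma artinSchreierClass_of_commPair (h2 : (2 : F) = 0) {ε η : F}
    (h : PresentedBy N (commPair 1 ε)) (h' : PresentedBy N (commPair 1 η)) :
    ArtinSchreierClass F η ε := by
  obtain ⟨x, y, z, w, hd, h1, h3⟩ := commPair_relation h h'
  -- The determinant is a value of the norm form with parameter `ε`, at `(w, y)`; its product with
  -- `η` will be the value at `(z, x)`.
  have hc : x * w + y * z = w ^ 2 + w * y + ε * y ^ 2 := by
    linear_combination -h3 + (z * w - ε * x * y - ε * y ^ 2 - w * y) * h2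
  refine artinSchreierClass_of_norm h2 (x := w) (y := y) (z := z) (w := x) (c := x * w + y * z)
    (fun h0 => hd (by linear_combination h0 - y * z * h2)) ?_ (by ring) ?_
  · exact hc
  · linear_combination η * hc - h1 + (η * w ^ 2 - z * x - ε * x ^ 2) * h2

end Symmetric

/-! ### Pairs of binary forms with an asymmetric member. -/

section Asymmetric

variable {F N : Type*} [Field F] [NonUnitalRing N] [Module F N]

/-- The rows of the base change in the source are `(x, y)`, `(z, w)`; the rows `(a, b)`, `(c, d)`
express the transformed old forms by the new ones. -/
lemma PresentedBy.change_pair {s₁ s₂ s₃ s₄ t₁ t₂ t₃ t₄ s₁' s₂' s₃' s₄' t₁' t₂' t₃' t₄' : F}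
    (h : PresentedBy N ![!![s₁, s₂; s₃, s₄], !![t₁, t₂; t₃, t₄]])
    (x y z w a b c d : F) (hP : x * w - y * z ≠ 0) (hQ : a * d - b * c ≠ 0)
    (hs : s₁ * x * x + s₂ * x * y + s₃ * y * x + s₄ * y * y = a * s₁' + b * t₁' ∧
      s₁ * x * z + s₂ * x * w + s₃ * y * z + s₄ * y * w = a * s₂' + b * t₂' ∧
      s₁ * z * x + s₂ * z * y + s₃ * w * x + s₄ * w * y = a * s₃' + b * t₃' ∧
      s₁ * z * z + s₂ * z * w + s₃ * w * z + s₄ * w * w = a * s₄' + b * t₄')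
    (ht : t₁ * x * x + t₂ * x * y + t₃ * y * x + t₄ * y * y = c * s₁' + d * t₁' ∧
      t₁ * x * z + t₂ * x * w + t₃ * y * z + t₄ * y * w = c * s₂' + d * t₂' ∧
      t₁ * z * x + t₂ * z * y + t₃ * w * x + t₄ * w * y = c * s₃' + d * t₃' ∧
      t₁ * z * z + t₂ * z * w + t₃ * w * z + t₄ * w * w = c * s₄' + d * t₄') :
    PresentedBy N ![!![s₁', s₂'; s₃', s₄'], !![t₁', t₂'; t₃', t₄']] :=
  h.of_formsSim (formsSim_pair_entries.2 ⟨x, y, z, w, a, b, c, d, hP, hQ, hs, ht⟩)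

/-- The antisymmetric part is a nonzero linear functional on the pencil, so its kernel is a line,
spanned by a symmetric form. -/
lemma exists_symm_asymm {s₁ s₂ s₃ s₄ t₁ t₂ t₃ t₄ : F}
    (h : PresentedBy N ![!![s₁, s₂; s₃, s₄], !![t₁, t₂; t₃, t₄]])
    (hi : FormsIndep ![!![s₁, s₂; s₃, s₄], !![t₁, t₂; t₃, t₄]])
    (hns : s₂ ≠ s₃ ∨ t₂ ≠ t₃) :
    ∃ p q r t₁ t₂ t₃ t₄ : F, PresentedBy N ![!![p, q; q, r], !![t₁, t₂; t₃, t₄]] ∧ t₂ ≠ t₃ ∧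
      (p ≠ 0 ∨ q ≠ 0 ∨ r ≠ 0) := by
  rw [formsIndep_pair_entries] at hi
  have key : ∀ k, ¬ (s₁ - k * t₁ = 0 ∧ s₂ - k * t₂ = 0 ∧ s₃ - k * t₃ = 0 ∧ s₄ - k * t₄ = 0) := by
    rintro k ⟨h1, h2, h3, h4⟩
    exact one_ne_zero (hi 1 (-k) (by linear_combination h1) (by linear_combination h2)
      (by linear_combination h3) (by linear_combination h4)).1
  by_cases ht : t₂ = t₃
  · have hs : s₂ ≠ s₃ := by tauto
    refine ⟨t₁, t₂, t₄, s₁, s₂, s₃, s₄, h.change_pair 1 0 0 1 0 1 1 0 (by simp) (by simp)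
      (by simp) ⟨by ring, by ring, by linear_combination -ht, by ring⟩, hs, ?_⟩
    by_contra! h0
    obtain ⟨h1, h2, h4⟩ := h0
    exact one_ne_zero (hi 0 1 (by simpa using h1) (by simpa using h2)
      (by simpa [← ht] using h2) (by simpa using h4)).2
  · have ht' : t₂ - t₃ ≠ 0 := sub_ne_zero.2 ht
    obtain ⟨k, hk⟩ : ∃ k, k = (s₂ - s₃) / (t₂ - t₃) := ⟨_, rfl⟩
    have hk' : s₂ - k * t₂ = s₃ - k * t₃ := by
      rw [eq_div_iff ht'] at hk
      linear_combination -hk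
    refine ⟨s₁ - k * t₁, s₂ - k * t₂, s₄ - k * t₄, t₁, t₂, t₃, t₄,
      h.change_pair 1 0 0 1 1 k 0 1 (by simp) (by simp) ?_ (by simp), ht, ?_⟩
    · refine ⟨by ring, by ring, ?_, by ring⟩
      linear_combination -hk'
    · by_contra! h0
      exact key k ⟨h0.1, h0.2.1, hk' ▸ h0.2.1, h0.2.2⟩

/-- Pairs of forms the first of which is diagonal. -/
def diagPair (ρ b c d : F) : Fin 2 → Matrix (Fin 2) (Fin 2) F := ![!![1, 0; 0, ρ], !![0, b; c, d]]

/-- Pairs of forms the first of which is hyperbolic. -/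
def hypPair (a d : F) : Fin 2 → Matrix (Fin 2) (Fin 2) F := ![!![0, 1; 1, 0], !![a, 1; 0, d]]

/-- The vector `e₂ - (q / p) e₁` is orthogonal to `e₁` for the symmetric form. A multiple of this
form is then subtracted from the other one to clear its first entry. -/
lemma exists_diagPair_of_ne_zero {p q r t₁ t₂ t₃ t₄ : F}
    (h : PresentedBy N ![!![p, q; q, r], !![t₁, t₂; t₃, t₄]]) (ht : t₂ ≠ t₃) (hp : p ≠ 0) :
    ∃ ρ b c d : F, PresentedBy N (diagPair ρ b c d) ∧ b ≠ c := by
  refine ⟨(r - q ^ 2 / p) / p, t₂ - q / p * t₁, t₃ - q / p * t₁,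
    t₄ - q / p * (t₂ + t₃) + (q / p) ^ 2 * t₁ - t₁ * ((r - q ^ 2 / p) / p),
    h.change_pair 1 0 (-(q / p)) 1 p 0 t₁ 1 (by simp) (by simpa) ?_ ?_, fun h => ht ?_⟩
  · refine ⟨by ring, ?_, ?_, ?_⟩ <;> field_simp <;> ring
  · refine ⟨?_, ?_, ?_, ?_⟩ <;> ring
  · linear_combination h

lemma exists_diagPair_or_hypPair {p q r t₁ t₂ t₃ t₄ : F}
    (h : PresentedBy N ![!![p, q; q, r], !![t₁, t₂; t₃, t₄]]) (ht : t₂ ≠ t₃)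
    (hs : p ≠ 0 ∨ q ≠ 0 ∨ r ≠ 0) :
    (∃ ρ b c d : F, PresentedBy N (diagPair ρ b c d) ∧ b ≠ c) ∨
      ((2 : F) = 0 ∧ ∃ a d : F, PresentedBy N (hypPair a d)) := by
  by_cases hp : p = 0
  swap
  · exact Or.inl (exists_diagPair_of_ne_zero h ht hp)
  by_cases hr : r = 0
  swap
  · exact Or.inl (exists_diagPair_of_ne_zero (p := r) (q := q) (r := p) (t₁ := t₄) (t₂ := t₃)
      (t₃ := t₂) (t₄ := t₁) (h.change_pair 0 1 1 0 1 0 0 1 (by simp) (by simp) (by simp)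
        (by simp)) ht.symm hr)
  have hq : q ≠ 0 := by tauto
  subst hp hr
  by_cases h2 : (2 : F) = 0
  swap
  -- The vector `e₁ + e₂` has value `2 q`, so only in characteristic two does a hyperbolic form
  -- resist diagonalization.
  · refine Or.inl (exists_diagPair_of_ne_zero (p := 2 * q) (q := q) (r := 0)
      (t₁ := t₁ + t₂ + t₃ + t₄) (t₂ := t₂ + t₄) (t₃ := t₃ + t₄) (t₄ := t₄)
      (h.change_pair 1 1 0 1 1 0 0 1 (by simp) (by simp) ?_ ?_)
      (fun h => ht (add_right_cancel h)) (mul_ne_zero h2 hq))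
    · refine ⟨?_, ?_, ?_, ?_⟩ <;> ring
    · refine ⟨?_, ?_, ?_, ?_⟩ <;> ring
  · have ht' : t₂ - t₃ ≠ 0 := sub_ne_zero.2 ht
    refine Or.inr ⟨h2, t₁ / (t₂ - t₃), t₄ / (t₂ - t₃),
      h.change_pair 1 0 0 1 q 0 t₃ (t₂ - t₃) (by simp) (by simpa using ⟨hq, ht'⟩) (by simp) ?_⟩
    refine ⟨?_, by ring, by ring, ?_⟩
    · rw [mul_div_cancel₀ _ ht']
      ring
    · rw [mul_div_cancel₀ _ ht']
      ring

lemma exists_U4 {ρ b c d : F} (h : PresentedBy N (diagPair ρ b c d)) (hbc : b ≠ c) (hρ : ρ ≠ 0) :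
    ∃ β₁ β₂ : F, β₁ ≠ 1 ∧ PresentedBy N (diagPair ρ 1 β₁ β₂) := by
  by_cases hb : b = 0
  · subst hb
    have hc : c ≠ 0 := hbc.symm
    -- The basis `e₂, ρ e₁` preserves the diagonal form up to the factor `ρ` and brings `c` to the
    -- place of `b`.
    refine ⟨0, -d / c, zero_ne_one, h.change_pair 0 1 ρ 0 ρ 0 d (c * ρ) (by simpa)
      (by simpa using ⟨hρ, hc, hρ⟩) ?_ ?_⟩
    · refine ⟨?_, ?_, ?_, ?_⟩ <;> ring
    · refine ⟨by ring, by ring, by ring, ?_⟩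
      field_simp
      ring
  · refine ⟨c / b, d / b, fun h => hbc ?_, h.change_pair 1 0 0 1 1 0 0 b (by simp) (by simpa)
      (by simp) ?_⟩
    · rw [div_eq_one_iff_eq hb] at h
      exact h.symm
    · refine ⟨by ring, by ring, ?_, ?_⟩
      · field_simp
        ring
      · field_simp
        ring

lemma PresentedBy.diagPair_of_sqClass {ρ σ β₁ β₂ : F} (h : PresentedBy N (diagPair ρ 1 β₁ β₂))
    (hρ : SqClass F ρ σ) : ∃ β₂', PresentedBy N (diagPair σ 1 β₁ β₂') := by
  obtain ⟨k, hk, rfl⟩ := hρ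
  refine ⟨β₂ / k, h.change_pair 1 0 0 (1 / k) 1 0 0 (1 / k) (by simpa) (by simpa) ?_ ?_⟩
  · refine ⟨by ring, by ring, by ring, ?_⟩
    field_simp
    ring
  · refine ⟨by ring, by ring, by ring, ?_⟩
    field_simp
    ring

lemma PresentedBy.diagPair_of_aRel {ρ β₁ β₂ γ₁ γ₂ : F} (h : PresentedBy N (diagPair ρ 1 β₁ β₂))
    (hA : ARel ρ (β₁, β₂) (γ₁, γ₂)) : PresentedBy N (diagPair ρ 1 γ₁ γ₂) := by
  have sq : ∀ e : F, e = 1 ∨ e = -1 → e * e = 1 := by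
    rintro e (rfl | rfl) <;> simp
  rcases hA with ⟨e, he, heq⟩ | ⟨t, e, he, hne, h1, h2⟩
  · obtain ⟨rfl, rfl⟩ := Prod.mk.inj heq
    have he' := sq e he
    have he0 : e ≠ 0 := left_ne_zero_of_mul_eq_one he'
    refine h.change_pair 1 0 0 e 1 0 0 e (by simpa) (by simpa) ?_ ?_
    · refine ⟨by ring, by ring, by ring, ?_⟩
      linear_combination ρ * he'
    · refine ⟨by ring, by ring, by ring, by ring⟩
  · have he' := sq e he
    have he0 : e ≠ 0 := left_ne_zero_of_mul_eq_one he'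
    simp only at hne h1 h2
    obtain ⟨m, hm⟩ : ∃ m, m = t ^ 2 + β₂ * t - ρ * β₁ := ⟨_, rfl⟩
    rw [← hm] at hne h1 h2
    have hm0 := right_ne_zero_of_mul hne
    have hd := left_ne_zero_of_mul hne
    rw [eq_div_iff hm0] at h1
    have h2' : γ₂ * m = e * (β₂ * t ^ 2 - 2 * ρ * (β₁ + 1) * t - ρ * β₂) := by
      rw [h2]
      field_simp
    -- The first new vector is `t e₁ + e₂`; the second is orthogonal to it for `diag(1, ρ)`, with
    -- `ρ` times its value. The second form takes the value `e m` on this pair, which is normalized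
    -- to 1.
    refine h.change_pair t 1 (-(e * ρ)) (e * t) (t ^ 2 + ρ) 0 (t + β₁ * t + β₂) (e * m)
      ?_ ?_ ?_ ?_
    · rw [show t * (e * t) - 1 * -(e * ρ) = e * (t ^ 2 + ρ) by ring]
      exact mul_ne_zero he0 hd
    · rw [zero_mul, sub_zero]
      exact mul_ne_zero hd (mul_ne_zero he0 hm0)
    · refine ⟨by ring, by ring, by ring, ?_⟩
      linear_combination ρ * (t ^ 2 + ρ) * he'
    · refine ⟨by ring, ?_, ?_, ?_⟩
      · linear_combination -e * hm
      · linear_combination -e * h1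
      · linear_combination -e * h2' + (β₂ * t ^ 2 - ρ * t - ρ * β₁ * t) * he' -
          (β₂ * t ^ 2 - 2 * ρ * (β₁ + 1) * t - ρ * β₂) * he'

lemma exists_U3 {b c d : F} (h : PresentedBy N (diagPair 0 b c d)) (hbc : b ≠ c) :
    PresentedBy N (diagPair (0 : F) 0 1 0) ∨ PresentedBy N (diagPair (0 : F) 0 1 1) ∨
      ∃ l : F, l ≠ 1 ∧ PresentedBy N (diagPair 0 1 l 0) := by
  by_cases hd : d = 0
  · subst hd
    by_cases hb : b = 0
    · subst hb
      exact Or.inl (h.change_pair 1 0 0 1 1 0 0 c (by simp) (by simpa using hbc.symm)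
        (by simp) (by simp))
    · refine Or.inr (Or.inr ⟨c / b, fun h => hbc ?_, h.change_pair 1 0 0 1 1 0 0 b (by simp)
        (by simpa) (by simp) ?_⟩)
      · rw [div_eq_one_iff_eq hb] at h
        exact h.symm
      · refine ⟨by ring, by ring, ?_, by ring⟩
        field_simp
        ring
  · have hcb : c - b ≠ 0 := sub_ne_zero.2 hbc.symm
    -- Subtracting `(b / d) e₂` from `e₁` clears the upper off-diagonal entry; scaling `e₂` by `(c -
    -- b) / d` equalizes the two entries of the lower row.
    refine Or.inr (Or.inl (h.change_pair 1 (-(b / d)) 0 ((c - b) / d) 1 0 (-(b * c / d))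
      ((c - b) ^ 2 / d) ?_ ?_ ?_ ?_))
    · simpa using ⟨hcb, hd⟩
    · simpa using ⟨hcb, hd⟩
    · simp
    · refine ⟨?_, ?_, ?_, ?_⟩ <;> field_simp <;> ring

/-- It suffices to make the first diagonal entry nonzero and then rescale. If it is zero the basis
is exchanged, or `e₁` is replaced by `e₁ + e₂` when both diagonal entries vanish. -/
lemma exists_U5 (h2 : (2 : F) = 0) {a d : F} (h : PresentedBy N (hypPair a d)) :
    ∃ ε : F, PresentedBy N (hypPair 1 ε) := by
  have key : ∀ a d : F, a ≠ 0 → PresentedBy N (hypPair a d) →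
      ∃ ε : F, PresentedBy N (hypPair 1 ε) := by
    intro a d ha h
    refine ⟨a * d, h.change_pair 1 0 0 a a 0 0 a (by simpa) (by simpa) (by simp) ?_⟩
    refine ⟨by ring, by ring, by ring, by ring⟩
  by_cases ha : a = 0
  swap
  · exact key a d ha h
  subst ha
  by_cases hd : d = 0
  · subst hd
    refine ⟨0, h.change_pair 1 1 0 1 1 0 0 1 (by simp) (by simp) ?_ (by simp)⟩
    refine ⟨?_, by ring, by ring, by ring⟩
    linear_combination h2
  · refine key d 0 hd (h.change_pair 0 1 1 0 1 0 1 1 (by simp) (by simp) (by simp) ?_)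
    refine ⟨by ring, ?_, by ring, by ring⟩
    linear_combination -h2

lemma PresentedBy.hypPair_of_artinSchreierClass (h2 : (2 : F) = 0) {ε η : F}
    (h : PresentedBy N (hypPair 1 ε)) (hε : ArtinSchreierClass F ε η) :
    PresentedBy N (hypPair 1 η) := by
  obtain ⟨l, hl⟩ := hε
  refine h.change_pair 1 0 l 1 1 0 l 1 (by simp) (by simp) ?_ ?_
  · refine ⟨by ring, by ring, by ring, ?_⟩
    linear_combination l * h2
  · refine ⟨by ring, by ring, by ring, ?_⟩
    linear_combination hl + (l ^ 2 + l) * h2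

/-! ### Invariants of the normal forms -/

lemma formsIndep_diagPair {ρ b c d : F} (hbc : b ≠ c) : FormsIndep (diagPair ρ b c d) := by
  unfold diagPair
  rw [formsIndep_pair_entries]
  intro k l h1 h2 h3 _
  refine ⟨by simpa using h1, ?_⟩
  by_contra hl
  have hb : b = 0 := by simpa [hl] using h2
  have hc : c = 0 := by simpa [hl] using h3
  exact hbc (hb.trans hc.symm)

lemma formsIndep_hypPair (a d : F) : FormsIndep (hypPair a d) := by
  unfold hypPair
  rw [formsIndep_pair_entries]
  intro k l _ h2 h3 _
  have hk : k = 0 := by simpa using h3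
  exact ⟨hk, by simpa [hk] using h2⟩

/-- Two presentations of the same algebra by a diagonal and an asymmetric form. -/
lemma diagPair_relation {ρ b c d ρ' b' c' d' : F} (hbc : b ≠ c)
    (h : PresentedBy N (diagPair ρ b c d)) (h' : PresentedBy N (diagPair ρ' b' c' d')) :
    ∃ x y z w k m n : F, x * w - y * z ≠ 0 ∧ k ≠ 0 ∧ n ≠ 0 ∧
      (x ^ 2 + ρ' * y ^ 2 = k ∧ x * z + ρ' * y * w = 0 ∧ z ^ 2 + ρ' * w ^ 2 = k * ρ) ∧
      b' * x * y + c' * y * x + d' * y * y = m ∧ b' * x * w + c' * y * z + d' * y * w = n * b ∧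
        b' * z * y + c' * w * x + d' * w * y = n * c ∧
        b' * z * w + c' * w * z + d' * w * w = m * ρ + n * d := by
  obtain ⟨x, y, z, w, k, l, m, n, hP, hQ, ⟨h1, h2, h3, h4⟩, h5, h6, h7, h8⟩ :=
    formsSim_pair_entries.1 (h.formsSim (formsIndep_diagPair hbc) h')
  -- A congruence keeps the first form symmetric, and since `b ≠ c` the symmetric members of the
  -- target pencil are the multiples of its first form.
  have hl : l = 0 := by
    have : l * (b - c) = 0 := by linear_combination h3 - h2
    exact (mul_eq_zero.1 this).resolve_right (sub_ne_zero.2 hbc)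
  subst hl
  rw [zero_mul, sub_zero] at hQ
  refine ⟨x, y, z, w, k, m, n, hP, left_ne_zero_of_mul hQ, right_ne_zero_of_mul hQ,
    ⟨?_, ?_, ?_⟩, ?_, ?_, ?_, ?_⟩
  · linear_combination h1
  · linear_combination h2
  · linear_combination h4
  · linear_combination h5
  · linear_combination h6
  · linear_combination h7
  · linear_combination h8

/-- The symmetric member is unique up to scalars, and its determinant changes by squares. -/
lemma sqClass_of_diagPair {ρ b c d ρ' b' c' d' : F} (hbc : b ≠ c)
    (h : PresentedBy N (diagPair ρ b c d)) (h' : PresentedBy N (diagPair ρ' b' c' d')) :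
    SqClass F ρ' ρ := by
  obtain ⟨x, y, z, w, k, m, n, hP, hk, -, ⟨h1, h2, h3⟩, -⟩ := diagPair_relation hbc h h'
  refine ⟨k / (x * w - y * z), div_ne_zero hk hP, ?_⟩
  rw [div_pow, div_mul_eq_mul_div, eq_div_iff (pow_ne_zero 2 hP)]
  linear_combination (z ^ 2 + ρ' * w ^ 2) * h1 + k * h3 - (x * z + ρ' * y * w) * h2

/-- In characteristic two the symmetric member is alternating on one side and takes the value 1 on
the other. -/
lemma not_hypPair_diagPair (h2 : (2 : F) = 0) {ρ b c d a d' : F} (hbc : b ≠ c)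
    (h : PresentedBy N (diagPair ρ b c d)) (h' : PresentedBy N (hypPair a d')) : False := by
  obtain ⟨x, y, z, w, k, l, m, n, hP, hQ, ⟨h1, h3, h4, -⟩, -⟩ :=
    formsSim_pair_entries.1 (h.formsSim (formsIndep_diagPair hbc) h')
  have hl : l = 0 := by
    have : l * (b - c) = 0 := by linear_combination h4 - h3
    exact (mul_eq_zero.1 this).resolve_right (sub_ne_zero.2 hbc)
  subst hl
  have hk : k = 0 := by linear_combination -h1 + x * y * h2
  simp [hk] at hQ

/-- The second form takes the norm values `x² + x y + η y²` on the diagonal, where the first form is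
zero, so multiples of the first form do not disturb them. -/
lemma artinSchreierClass_of_hypPair (h2 : (2 : F) = 0) {ε η : F}
    (h : PresentedBy N (hypPair 1 ε)) (h' : PresentedBy N (hypPair 1 η)) :
    ArtinSchreierClass F ε η := by
  obtain ⟨x, y, z, w, k, l, m, n, hP, hQ, ⟨h1, h3, h4, -⟩, h5, h6, h7, h8⟩ :=
    formsSim_pair_entries.1 (h.formsSim (formsIndep_hypPair 1 ε) h')
  have hn : n = x * w + y * z := by
    linear_combination h7 - h6 - y * z * h2
  refine artinSchreierClass_of_norm h2 (x := x) (y := y) (z := z) (w := w) (c := n) ?_ ?_ hn ?_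
  · rintro rfl
    exact hP (by linear_combination -hn - y * z * h2)
  · linear_combination -h5
  · linear_combination -h8

/-- The vector `e₂` spans the radical of the symmetric member `diag(1, 0)`, so the base change is
triangular. -/
lemma U3_relation {b c d b' c' d' : F} (hbc : b ≠ c)
    (h : PresentedBy N (diagPair 0 b c d)) (h' : PresentedBy N (diagPair 0 b' c' d')) :
    ∃ x y w n : F, x ≠ 0 ∧ w ≠ 0 ∧ n ≠ 0 ∧ w * (b' * x + d' * y) = n * b ∧
      w * (c' * x + d' * y) = n * c ∧ d' * w ^ 2 = n * d := by
  obtain ⟨x, y, z, w, k, m, n, hP, hk, hn, ⟨h1, h2, h3⟩, h4, h5, h6, h7⟩ :=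
    diagPair_relation hbc h h'
  have hz : z = 0 := by simpa using h3
  subst hz
  have hxw : x * w ≠ 0 := by simpa using hP
  refine ⟨x, y, w, n, left_ne_zero_of_mul hxw, right_ne_zero_of_mul hxw, hn, ?_, ?_, ?_⟩
  · linear_combination h5
  · linear_combination h6
  · linear_combination h7

/-- The base change is a similitude of `diag(1, ρ)` with factor `k`, so its determinant is `± k` and
its second row is `± (-ρ y, x)`. The case `y = 0` is the change of sign in `ARel`, and otherwise `t
= x / y` is the parameter. -/
lemma aRel_of_diagPair {ρ β₁ β₂ γ₁ γ₂ : F} (hρ : ρ ≠ 0) (hβ : β₁ ≠ 1)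
    (h : PresentedBy N (diagPair ρ 1 β₁ β₂)) (h' : PresentedBy N (diagPair ρ 1 γ₁ γ₂)) :
    ARel ρ (γ₁, γ₂) (β₁, β₂) := by
  obtain ⟨x, y, z, w, k, m, n, hP, hk, hn, ⟨h1, h2, h3⟩, h4, h5, h6, h7⟩ :=
    diagPair_relation hβ.symm h h'
  obtain ⟨e, he, hek⟩ : ∃ e : F, (e = 1 ∨ e = -1) ∧ x * w - y * z = e * k := by
    have : ρ * (x * w - y * z) ^ 2 = ρ * k ^ 2 := by
      linear_combination (z ^ 2 + ρ * w ^ 2) * h1 + k * h3 - (x * z + ρ * y * w) * h2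
    rcases sq_eq_sq_iff_eq_or_eq_neg.1 (mul_left_cancel₀ hρ this) with h | h
    · exact ⟨1, Or.inl rfl, by linear_combination h⟩
    · exact ⟨-1, Or.inr rfl, by linear_combination h⟩
  have he' : e * e = 1 := by rcases he with rfl | rfl <;> simp
  have he0 : e ≠ 0 := left_ne_zero_of_mul_eq_one he'
  have hw : w = e * x := by
    apply mul_left_cancel₀ hk
    linear_combination -w * h1 + x * hek + y * h2
  have hz : z = -(e * ρ * y) := by
    apply mul_left_cancel₀ hk
    linear_combination -z * h1 + x * h2 - ρ * y * hek
  subst hw hz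
  by_cases hy : y = 0
  · subst hy
    have hx : x ≠ 0 := by
      rintro rfl
      simp at hP
    have hn' : n = e * x ^ 2 := by linear_combination -h5
    have hn0 := hn
    rw [hn'] at hn0
    refine Or.inl ⟨e, he, Prod.ext ?_ ?_⟩
    · apply mul_left_cancel₀ hn0
      linear_combination -h6 - β₁ * hn'
    · apply mul_left_cancel₀ hn0
      linear_combination -h7 - β₂ * hn' + ρ * h4
  · obtain ⟨t, rfl⟩ : ∃ t, x = t * y := ⟨x / y, by field_simp⟩
    obtain ⟨D, hD⟩ : ∃ D, D = t ^ 2 + γ₂ * t - ρ * γ₁ := ⟨_, rfl⟩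
    have hn' : n = e * y ^ 2 * D := by linear_combination -h5 - e * y ^ 2 * hD
    have hD0 : D ≠ 0 := right_ne_zero_of_mul (hn' ▸ hn)
    have hk' : k = y ^ 2 * (t ^ 2 + ρ) := by linear_combination -h1
    have hc : e * y ^ 2 ≠ 0 := mul_ne_zero he0 (pow_ne_zero 2 hy)
    refine Or.inr ⟨t, e, he, ?_, ?_, ?_⟩
    · simp only
      rw [← hD]
      exact mul_ne_zero (right_ne_zero_of_mul (hk' ▸ hk)) hD0
    · simp only
      rw [← hD, eq_div_iff hD0]
      apply mul_left_cancel₀ hc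
      linear_combination -h6 - β₁ * hn'
    · simp only
      rw [← hD, ← mul_div_assoc, eq_div_iff hD0]
      apply mul_left_cancel₀ hc
      linear_combination -h7 - β₂ * hn' + ρ * h4 + y ^ 2 * ρ * (t + t * γ₁ + γ₂) * he'

end Asymmetric

/-! ### Properties preserved by isomorphisms. -/

section Invariants

variable {F N M : Type*} [Field F] [NonUnitalRing N] [Module F N] [NonUnitalRing M] [Module F M]

lemma AlgIso.comm (h : AlgIso F N M) (hM : ∀ x y : M, x * y = y * x) (x y : N) :
    x * y = y * x := by
  obtain ⟨f, hf⟩ := h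
  apply hf.1
  rw [map_mul, map_mul, hM]

lemma AlgIso.mul_mul_eq_zero (h : AlgIso F N M) (hM : ∀ x y z : M, x * y * z = 0) (x y z : N) :
    x * y * z = 0 := by
  obtain ⟨f, hf⟩ := h
  apply hf.1
  rw [map_mul, map_mul, hM, map_zero]

lemma AlgIso.mul_mul_mul_eq_zero (h : AlgIso F N M) (hM : ∀ x y z w : M, x * y * z * w = 0)
    (x y z w : N) : x * y * z * w = 0 := by
  obtain ⟨f, hf⟩ := h
  apply hf.1
  rw [map_mul, map_mul, map_mul, hM, map_zero]

/-- This property of left annihilators separates `S32sharp` from `S41`, and `U2_01011` from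
`U2_01001`. -/
lemma AlgIso.annihilator_product (h : AlgIso F N M)
    (hM : ∀ x : M, (∀ y, x * y = 0) → ∃ u v, x = u * v) (x : N) (hx : ∀ y, x * y = 0) :
    ∃ u v, x = u * v := by
  obtain ⟨f, hf⟩ := h
  obtain ⟨u, v, huv⟩ := hM (f x) fun y => by
    obtain ⟨y, rfl⟩ := hf.2 y
    rw [← map_mul, hx, map_zero]
  obtain ⟨u, rfl⟩ := hf.2 u
  obtain ⟨v, rfl⟩ := hf.2 v
  exact ⟨u, v, hf.1 (by rw [huv, map_mul])⟩

/-- Both `s` and `t` represent `s`; symmetry and transitivity of `r` play no role. -/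
lemma IsRepSet.eq {α : Type*} {r : α → α → Prop} {X S : Set α} (h : IsRepSet r X S) {s t : α}
    (hs : s ∈ S) (ht : t ∈ S) (hss : r s s) (hst : r s t) : s = t :=
  (h.2 s (h.1 hs)).unique ⟨hs, hss⟩ ⟨ht, hst⟩

lemma formsIndep_single {n : ℕ} {D : Matrix (Fin n) (Fin n) F} (hD : D ≠ 0) :
    FormsIndep (fun _ : Fin 1 => D) := by
  intro c hc
  ext k
  fin_cases k
  simpa [hD] using hc

lemma projCongruent_of_formsSim {D E : Matrix (Fin 3) (Fin 3) F}
    (h : FormsSim (fun _ : Fin 1 => D) (fun _ : Fin 1 => E)) : ProjCongruent D E := by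
  obtain ⟨P, Q, hP, hQ, h⟩ := h
  rw [Matrix.isUnit_iff_isUnit_det, isUnit_iff_ne_zero, Matrix.det_fin_one] at hQ
  exact ⟨P, Q 0 0, hP, hQ, by simpa using h 0⟩

lemma formsSim_of_projCongruent {D E : Matrix (Fin 3) (Fin 3) F} (h : ProjCongruent D E) :
    FormsSim (fun _ : Fin 1 => D) (fun _ : Fin 1 => E) := by
  obtain ⟨P, l, hP, hl, h⟩ := h
  refine ⟨P, !![l], hP, ?_, fun k => ?_⟩
  · rw [Matrix.isUnit_iff_isUnit_det, isUnit_iff_ne_zero, Matrix.det_fin_one]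
    exact hl
  · fin_cases k
    simpa using h

lemma ProjCongruent.refl (D : Matrix (Fin 3) (Fin 3) F) : ProjCongruent D D :=
  ⟨1, 1, isUnit_one, one_ne_zero, by simp⟩

lemma projCongruent_of_presentedBy {D E : Matrix (Fin 3) (Fin 3) F}
    (hD : PresentedBy N (fun _ : Fin 1 => D)) (hE : PresentedBy N (fun _ : Fin 1 => E)) :
    ProjCongruent D E := by
  -- A single form is independent only if it is nonzero, so the zero form is compared separately.
  by_cases hE0 : E = 0
  · by_cases hD0 : D = 0
    · rw [hE0, hD0]
      exact ProjCongruent.refl 0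
    · obtain ⟨P, l, -, hl, h⟩ := projCongruent_of_formsSim (hD.formsSim (formsIndep_single hD0) hE)
      rw [hE0, mul_zero, zero_mul] at h
      exact absurd ((smul_eq_zero.1 h.symm).resolve_left hl) hD0
  · exact projCongruent_of_formsSim (hE.formsSim (formsIndep_single hE0) hD)

/-- The square has dimension two on one side and at most one on the other. -/
lemma not_presentedBy_pair_and_single {n : ℕ} {S : Fin 2 → Matrix (Fin n) (Fin n) F}
    (hS : FormsIndep S) {D : Matrix (Fin 3) (Fin 3) F} (h : PresentedBy N S)
    (hD : PresentedBy N (fun _ : Fin 1 => D)) : False := by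
  have := h.card_le hS hD
  omega

end Invariants

/-! ### Invariants of the rows with nonzero cube. -/

section RowInvariants

variable {F : Type*} [Field F]

lemma CommRow.mul_comm_S5 (x y : (CommRow.S5 (F := F)).algebra) : x * y = y * x := by
  obtain ⟨_, a, b, c, d, rfl⟩ := x
  obtain ⟨_, a', b', c', d', rfl⟩ := y
  have key : ∀ a b c d a' b' c' d' : F, CommRow.mat .S5 a b c d * CommRow.mat .S5 a' b' c' d' =
      CommRow.mat .S5 0 (a * a') (a * b' + b * a') (a * c' + b * b' + c * a') := by
    intros
    simp [CommRow.mat, vec5_zero, add_assoc]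
  refine Subtype.ext ?_
  rw [NonUnitalSubalgebra.coe_mul, NonUnitalSubalgebra.coe_mul, key, key]
  congr 1 <;> ring

lemma CommRow.mul_comm_S41 (x y : (CommRow.S41 (F := F)).algebra) : x * y = y * x := by
  obtain ⟨_, a, b, c, d, rfl⟩ := x
  obtain ⟨_, a', b', c', d', rfl⟩ := y
  have key : ∀ a b c d a' b' c' d' : F, CommRow.mat .S41 a b c d * CommRow.mat .S41 a' b' c' d' =
      CommRow.mat .S41 0 (a * a') (a * b' + b * a') 0 := by
    intros
    simp [CommRow.mat, vec5_zero]
  refine Subtype.ext ?_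
  rw [NonUnitalSubalgebra.coe_mul, NonUnitalSubalgebra.coe_mul, key, key]
  congr 1 <;> ring

lemma CommRow.mul_comm_S32sharp (x y : (CommRow.S32sharp (F := F)).algebra) :
    x * y = y * x := by
  obtain ⟨_, a, b, c, d, rfl⟩ := x
  obtain ⟨_, a', b', c', d', rfl⟩ := y
  have key : ∀ a b c d a' b' c' d' : F, CommRow.mat .S32sharp a b c d *
      CommRow.mat .S32sharp a' b' c' d' = CommRow.mat .S32sharp 0 (a * a') 0 (a * b' + b * a' + c * c') := by
    intros
    simp [CommRow.mat, vec5_zero, add_assoc]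
  refine Subtype.ext ?_
  rw [NonUnitalSubalgebra.coe_mul, NonUnitalSubalgebra.coe_mul, key, key]
  congr 1 <;> ring

/-- An element of a row algebra. -/
def CommRow.elt (r : CommRow F) (a b c d : F) : r.algebra := ⟨r.mat a b c d, a, b, c, d, rfl⟩

/-- An element of a row algebra. -/
def NoncommRow.elt (r : NoncommRow F) (a b c d : F) : r.algebra :=
  ⟨r.mat a b c d, a, b, c, d, rfl⟩

lemma CommRow.coe_elt (r : CommRow F) (a b c d : F) :
    (r.elt a b c d : Matrix (Fin 5) (Fin 5) F) = r.mat a b c d := rfl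

lemma NoncommRow.coe_elt (r : NoncommRow F) (a b c d : F) :
    (r.elt a b c d : Matrix (Fin 5) (Fin 5) F) = r.mat a b c d := rfl

lemma NoncommRow.not_comm_U2_01011 :
    ¬ ∀ x y : (NoncommRow.U2_01011 (F := F)).algebra, x * y = y * x := by
  intro h
  have := congrArg Subtype.val (h (NoncommRow.elt _ 1 0 0 0) (NoncommRow.elt _ 0 0 1 0))
  simp [NoncommRow.coe_elt, NoncommRow.mat, vec5_zero] at this

lemma NoncommRow.not_comm_U2_01001 :
    ¬ ∀ x y : (NoncommRow.U2_01001 (F := F)).algebra, x * y = y * x := by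
  intro h
  have := congrArg Subtype.val (h (NoncommRow.elt _ 1 0 0 0) (NoncommRow.elt _ 0 0 1 0))
  simp [NoncommRow.coe_elt, NoncommRow.mat, vec5_zero] at this

/-- The rows of the commutative table with nonzero cube. -/
def CommRow.Cubic (r : CommRow F) : Prop := r = .S5 ∨ r = .S41 ∨ r = .S32sharp

/-- The rows of the noncommutative table with nonzero cube. -/
def NoncommRow.Cubic (r : NoncommRow F) : Prop := r = .U2_01011 ∨ r = .U2_01001

lemma CommRow.mul_mul_eq_zero {r : CommRow F} (hr : ¬ r.Cubic) (x y z : r.algebra) :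
    x * y * z = 0 := by
  cases r with
  | S5 => exact absurd (Or.inl rfl) hr
  | S41 => exact absurd (Or.inr (Or.inl rfl)) hr
  | S32sharp => exact absurd (Or.inr (Or.inr rfl)) hr
  | U1_00 => exact presentedBy_U1_00.mul_mul_eq_zero x y z
  | U1_0 ρ => exact (presentedBy_U1_0 ρ).mul_mul_eq_zero x y z
  | U1_1 ε => exact (presentedBy_U1_1 ε).mul_mul_eq_zero x y z
  | RD D => exact (presentedBy_commRow_RD D).mul_mul_eq_zero x y z

lemma NoncommRow.mul_mul_eq_zero {r : NoncommRow F} (hr : ¬ r.Cubic) (x y z : r.algebra) :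
    x * y * z = 0 := by
  cases r with
  | U2_01011 => exact absurd (Or.inl rfl) hr
  | U2_01001 => exact absurd (Or.inr rfl) hr
  | U3_010 => exact presentedBy_U3_010.mul_mul_eq_zero x y z
  | U3_011 => exact presentedBy_U3_011.mul_mul_eq_zero x y z
  | U3_1 l => exact (presentedBy_U3_1 l).mul_mul_eq_zero x y z
  | U4 ρ β₁ β₂ => exact (presentedBy_U4 ρ β₁ β₂).mul_mul_eq_zero x y z
  | U5_11 ε => exact (presentedBy_U5_11 ε).mul_mul_eq_zero x y z
  | RD D => exact (presentedBy_noncommRow_RD D).mul_mul_eq_zero x y z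

lemma CommRow.Cubic.not_mul_mul_eq_zero {r : CommRow F} (hr : r.Cubic) :
    ¬ ∀ x y z : r.algebra, x * y * z = 0 := by
  intro h
  have := congrArg Subtype.val (h (r.elt 1 0 0 0) (r.elt 1 0 0 0) (r.elt 1 0 0 0))
  obtain rfl | rfl | rfl := hr <;> simp [CommRow.coe_elt, CommRow.mat, vec5_zero] at this <;>
    simp [← Matrix.ext_iff, Fin.forall_fin_succ] at this

lemma NoncommRow.Cubic.not_mul_mul_eq_zero {r : NoncommRow F} (hr : r.Cubic) :
    ¬ ∀ x y z : r.algebra, x * y * z = 0 := by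
  intro h
  have := congrArg Subtype.val (h (r.elt 1 0 0 0) (r.elt 1 0 0 0) (r.elt 1 0 0 0))
  obtain rfl | rfl := hr <;> simp [NoncommRow.coe_elt, NoncommRow.mat, vec5_zero] at this <;>
    simp [← Matrix.ext_iff, Fin.forall_fin_succ] at this

lemma CommRow.Cubic.of_algIso {r s : CommRow F} (hr : r.Cubic)
    (h : AlgIso F r.algebra s.algebra) : s.Cubic := by
  by_contra hs
  exact hr.not_mul_mul_eq_zero (h.mul_mul_eq_zero (CommRow.mul_mul_eq_zero hs))

lemma NoncommRow.Cubic.of_algIso {r s : NoncommRow F} (hr : r.Cubic)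
    (h : AlgIso F r.algebra s.algebra) : s.Cubic := by
  by_contra hs
  exact hr.not_mul_mul_eq_zero (h.mul_mul_eq_zero (NoncommRow.mul_mul_eq_zero hs))

lemma CommRow.S5_not_mul_eq_zero :
    ¬ ∀ x y z w : (CommRow.S5 (F := F)).algebra, x * y * z * w = 0 := by
  intro h
  have := congrArg Subtype.val (h (CommRow.elt _ 1 0 0 0) (CommRow.elt _ 1 0 0 0)
    (CommRow.elt _ 1 0 0 0) (CommRow.elt _ 1 0 0 0))
  simp [CommRow.coe_elt, CommRow.mat, vec5_zero] at this
  simp [← Matrix.ext_iff, Fin.forall_fin_succ] at this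

lemma CommRow.S41_mul_eq_zero (x y z w : (CommRow.S41 (F := F)).algebra) :
    x * y * z * w = 0 := by
  obtain ⟨_, a, b, c, d, rfl⟩ := x
  obtain ⟨_, a', b', c', d', rfl⟩ := y
  obtain ⟨_, a'', b'', c'', d'', rfl⟩ := z
  obtain ⟨_, a₃, b₃, c₃, d₃, rfl⟩ := w
  refine Subtype.ext ?_
  simp only [NonUnitalSubalgebra.coe_mul, CommRow.mat]
  simp [vec5_zero]
  ext i j
  fin_cases i <;> fin_cases j <;> rfl

lemma CommRow.S32sharp_mul_eq_zero (x y z w : (CommRow.S32sharp (F := F)).algebra) :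
    x * y * z * w = 0 := by
  obtain ⟨_, a, b, c, d, rfl⟩ := x
  obtain ⟨_, a', b', c', d', rfl⟩ := y
  obtain ⟨_, a'', b'', c'', d'', rfl⟩ := z
  obtain ⟨_, a₃, b₃, c₃, d₃, rfl⟩ := w
  refine Subtype.ext ?_
  simp only [NonUnitalSubalgebra.coe_mul, CommRow.mat]
  simp [vec5_zero]
  ext i j
  fin_cases i <;> fin_cases j <;> rfl

lemma CommRow.S32sharp_annihilator (x : (CommRow.S32sharp (F := F)).algebra)
    (hx : ∀ y, x * y = 0) : ∃ u v, x = u * v := by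
  obtain ⟨_, a, b, c, d, rfl⟩ := x
  have h1 := congrArg Subtype.val (hx (CommRow.elt _ 1 0 0 0))
  have h2 := congrArg Subtype.val (hx (CommRow.elt _ 0 0 1 0))
  obtain rfl : a = 0 := by simpa [CommRow.coe_elt, CommRow.mat] using congrFun (congrFun h1 0) 2
  obtain rfl : b = 0 := by simpa [CommRow.coe_elt, CommRow.mat] using congrFun (congrFun h1 0) 4
  obtain rfl : c = 0 := by simpa [CommRow.coe_elt, CommRow.mat] using congrFun (congrFun h2 0) 4
  refine ⟨CommRow.elt _ d 0 0 0, CommRow.elt _ 0 1 0 0, Subtype.ext ?_⟩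
  simp [CommRow.coe_elt, CommRow.mat, vec5_zero]

lemma CommRow.S41_annihilator :
    ¬ ∀ x : (CommRow.S41 (F := F)).algebra, (∀ y, x * y = 0) → ∃ u v, x = u * v := by
  intro h
  obtain ⟨⟨_, a, b, c, d, rfl⟩, ⟨_, a', b', c', d', rfl⟩, huv⟩ :=
    h (CommRow.elt _ 0 0 0 1) (by
      rintro ⟨_, a, b, c, d, rfl⟩
      refine Subtype.ext ?_
      simp [CommRow.coe_elt, CommRow.mat, vec5_zero]
      ext i j
      fin_cases i <;> fin_cases j <;> rfl)
  have := congrArg Subtype.val huv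
  simp [CommRow.coe_elt, CommRow.mat, vec5_zero] at this

lemma NoncommRow.U2_01011_annihilator (x : (NoncommRow.U2_01011 (F := F)).algebra)
    (hx : ∀ y, x * y = 0) : ∃ u v, x = u * v := by
  obtain ⟨_, a, b, c, d, rfl⟩ := x
  have h1 := congrArg Subtype.val (hx (NoncommRow.elt _ 1 0 0 0))
  have h2 := congrArg Subtype.val (hx (NoncommRow.elt _ 0 0 1 0))
  obtain rfl : a = 0 := by simpa [NoncommRow.coe_elt, NoncommRow.mat] using congrFun (congrFun h1 0) 2
  obtain rfl : b = 0 := by simpa [NoncommRow.coe_elt, NoncommRow.mat] using congrFun (congrFun h1 0) 4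
  obtain rfl : c = 0 := by simpa [NoncommRow.coe_elt, NoncommRow.mat] using congrFun (congrFun h2 0) 4
  refine ⟨NoncommRow.elt _ d 0 0 0, NoncommRow.elt _ 0 1 0 0, Subtype.ext ?_⟩
  simp [NoncommRow.coe_elt, NoncommRow.mat, vec5_zero]

lemma NoncommRow.U2_01001_annihilator :
    ¬ ∀ x : (NoncommRow.U2_01001 (F := F)).algebra, (∀ y, x * y = 0) → ∃ u v, x = u * v := by
  intro h
  obtain ⟨⟨_, a, b, c, d, rfl⟩, ⟨_, a', b', c', d', rfl⟩, huv⟩ :=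
    h (NoncommRow.elt _ 0 0 1 0) (by
      rintro ⟨_, a, b, c, d, rfl⟩
      refine Subtype.ext ?_
      simp [NoncommRow.coe_elt, NoncommRow.mat, vec5_zero]
      ext i j
      fin_cases i <;> fin_cases j <;> rfl)
  have := congrArg Subtype.val huv
  simp [NoncommRow.coe_elt, NoncommRow.mat, vec5_zero] at this

lemma CommRow.Cubic.eq_of_algIso {r s : CommRow F} (hr : r.Cubic) (hs : s.Cubic)
    (h : AlgIso F r.algebra s.algebra) : r = s := by
  obtain rfl | rfl | rfl := hr <;> obtain rfl | rfl | rfl := hs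
  · rfl
  · exact absurd (h.mul_mul_mul_eq_zero S41_mul_eq_zero) S5_not_mul_eq_zero
  · exact absurd (h.mul_mul_mul_eq_zero S32sharp_mul_eq_zero) S5_not_mul_eq_zero
  · exact absurd (h.symm.mul_mul_mul_eq_zero S41_mul_eq_zero) S5_not_mul_eq_zero
  · rfl
  · exact absurd (h.annihilator_product S32sharp_annihilator) S41_annihilator
  · exact absurd (h.symm.mul_mul_mul_eq_zero S32sharp_mul_eq_zero) S5_not_mul_eq_zero
  · exact absurd (h.symm.annihilator_product S32sharp_annihilator) S41_annihilator
  · rfl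

lemma NoncommRow.Cubic.eq_of_algIso {r s : NoncommRow F} (hr : r.Cubic) (hs : s.Cubic)
    (h : AlgIso F r.algebra s.algebra) : r = s := by
  obtain rfl | rfl := hr <;> obtain rfl | rfl := hs
  · rfl
  · exact absurd (h.symm.annihilator_product U2_01011_annihilator) U2_01001_annihilator
  · exact absurd (h.annihilator_product U2_01011_annihilator) U2_01001_annihilator
  · rfl

end RowInvariants

/-! ### The cases given by the dimensions of the powers. -/

section Existence

variable {F N : Type*} [Field F] [NonUnitalRing N] [Module F N]

lemma two_eq_zero_of_ringChar {F : Type*} [Field F] (h : ringChar F = 2) : (2 : F) = 0 := by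
  have := ringChar.Nat.cast_ringChar (R := F)
  rw [h] at this
  exact_mod_cast this

variable [IsScalarTower F N N] [SMulCommClass F N N]

/-- The four-dimensional nilpotent algebras, up to the classification of forms. -/
lemma structure_of_finrank_four (h4 : Module.finrank F N = 4) (hN : IsNilpotentAlgebra F N) :
    (∃ r : CommRow F, r.Cubic ∧ AlgIso F N r.algebra) ∨
      (∃ r : NoncommRow F, r.Cubic ∧ AlgIso F N r.algebra) ∨
      (∃ D : Matrix (Fin 3) (Fin 3) F, PresentedBy N (fun _ : Fin 1 => D)) ∨
      ∃ S T : Matrix (Fin 2) (Fin 2) F, PresentedBy N ![S, T] ∧ FormsIndep ![S, T] := by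
  have : FiniteDimensional F N := Module.finite_of_finrank_pos (by omega)
  by_cases h3 : 3 ≤ Module.finrank F (npow F N 1)
  · exact Or.inl ⟨.S5, Or.inl rfl, algIso_S5 hN h4 h3⟩
  by_cases hb2 : npow F N 2 = ⊥
  swap
  · have hb1 : npow F N 1 ≠ ⊥ := fun h => hb2 (eq_bot_iff.2 (h ▸ npow_succ_le 1))
    -- A strictly decreasing chain that starts at dimension at most two and has a nonzero cube must
    -- be 2, 1, 0.
    have hlt : Module.finrank F (npow F N 2) < Module.finrank F (npow F N 1) :=
      finrank_npow_succ_lt hN hb1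
    have hpos : Module.finrank F (npow F N 2) ≠ 0 := fun h => hb2 (Submodule.finrank_eq_zero.1 h)
    have h2 : Module.finrank F (npow F N 2) = 1 := by omega
    have h1 : Module.finrank F (npow F N 1) = 2 := by omega
    have hlt' : Module.finrank F (npow F N 3) < Module.finrank F (npow F N 2) :=
      finrank_npow_succ_lt hN hb2
    have hb3 : npow F N 3 = ⊥ := Submodule.finrank_eq_zero.1 (by omega)
    obtain h | h | h | h := algIso_of_finrank_npow_two h4 h1 h2 hb3
    · exact Or.inl ⟨_, Or.inr (Or.inl rfl), h⟩
    · exact Or.inl ⟨_, Or.inr (Or.inr rfl), h⟩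
    · exact Or.inr (Or.inl ⟨_, Or.inl rfl, h⟩)
    · exact Or.inr (Or.inl ⟨_, Or.inr rfl, h⟩)
  have hmul : ∀ x y : N, x * y ∈ npow F N 1 := fun x y =>
    mul_mem_npow_succ (k := 0) Submodule.mem_top y
  have hl : ∀ x ∈ npow F N 1, ∀ y : N, x * y = 0 := by
    intro x hx y
    have := mul_mem_npow_succ hx y
    rwa [hb2, Submodule.mem_bot] at this
  have hr : ∀ x : N, ∀ y ∈ npow F N 1, x * y = 0 := by
    intro x y hy
    have := mul_mem_npow_succ_of_right x hy
    rwa [hb2, Submodule.mem_bot] at this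
  have hcases : Module.finrank F (npow F N 1) = 0 ∨ Module.finrank F (npow F N 1) = 1 ∨
    Module.finrank F (npow F N 1) = 2 := by omega
  obtain h0 | h1 | h2 := hcases
  · have hb1 := Submodule.finrank_eq_zero.1 h0
    have hz : ∀ x y : N, x * y = 0 := fun x y => by simpa [hb1] using hmul x y
    obtain ⟨x, hx⟩ : ∃ x : N, x ≠ 0 := by
      have : Nontrivial N := Module.nontrivial_of_finrank_pos (R := F) (by omega)
      exact exists_ne 0
    -- With zero product any line can serve as target; it is not the square, so independence is not
    -- available.
    obtain ⟨S, hS, -⟩ := exists_presentedBy (m := 1) (n := 3) (F ∙ x) (finrank_span_singleton hx)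
      h4 (fun x y => by simp [hz]) (fun x _ y => hz x y) (fun x y _ => hz x y)
    refine Or.inr (Or.inr (Or.inl ⟨S 0, ?_⟩))
    convert hS using 2 with k
    rw [Subsingleton.elim k 0]
  · obtain ⟨S, hS, -⟩ := exists_presentedBy (m := 1) (n := 3) _ h1 h4 hmul hl hr
    refine Or.inr (Or.inr (Or.inl ⟨S 0, ?_⟩))
    convert hS using 2 with k
    rw [Subsingleton.elim k 0]
  · obtain ⟨S, hS, hi⟩ := exists_presentedBy (m := 2) (n := 2) _ h2 h4 hmul hl hr
    have hS2 : S = ![S 0, S 1] := by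
      ext k : 1
      fin_cases k <;> rfl
    refine Or.inr (Or.inr (Or.inr ⟨S 0, S 1, ?_, ?_⟩))
    · rwa [← hS2]
    · rw [← hS2]
      exact hi rfl

end Existence

/-! ### Every algebra occurs in the tables. -/

section Lists

variable {F N : Type*} [Field F] [NonUnitalRing N] [Module F N]
  {Q B C : Set F} {A : F → Set (F × F)} {PS PA : Set (Matrix (Fin 3) (Fin 3) F)}

lemma exists_commRow_of_commPair (hQ : IsSquareTransversal Q) (hB : ringChar F = 2 → IsBSet B)
    (hC : ringChar F = 2 → IsCSet Q C) {a ρ : F} (h : PresentedBy N (commPair a ρ)) :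
    ∃ r : CommRow F, r.Listed Q B C PS ∧ AlgIso F N r.algebra := by
  have toQ : ∀ ρ : F, ρ ≠ 0 → PresentedBy N (commPair 0 ρ) →
      ∃ s ∈ Q, PresentedBy N (commPair 0 s) := by
    intro ρ hρ h
    obtain ⟨s, ⟨hs, k, hk, hks⟩, -⟩ := hQ.2 ρ hρ
    refine ⟨s, hs, ?_⟩
    convert h.commPair_change 0 (inv_ne_zero hk) using 2
    · ring
    · rw [hks]
      field_simp
      ring
  by_cases hchar : ringChar F = 2
  · have h2 := two_eq_zero_of_ringChar hchar
    by_cases ha : a = 0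
    · subst ha
      obtain ⟨σ, hσ, hσN⟩ : ∃ σ : F, σ ≠ 0 ∧ PresentedBy N (commPair 0 σ) := by
        by_cases hρ : ρ = 0
        · subst hρ
          -- Replacing `e₂` by `e₁ + e₂` turns `ρ = 0` into `-1`, and the resulting coefficient 2 is
          -- zero; hence no analogue of `U1_00` is needed in characteristic two.
          refine ⟨-1, neg_ne_zero.2 one_ne_zero, ?_⟩
          convert h.commPair_change 1 one_ne_zero using 2
          · linear_combination -h2
          · ring
        · exact ⟨ρ, hρ, h⟩
      obtain ⟨s, hs, hsN⟩ := toQ σ hσ hσN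
      obtain ⟨c, ⟨hc, hsc⟩, -⟩ := (hC hchar).2 s hs
      exact ⟨.U1_0 c, Or.inr ⟨hchar, hc⟩,
        (hsN.commPair_of_starRel h2 hsc).algIso (presentedBy_U1_0 c)⟩
    · obtain ⟨ε, hε⟩ : ∃ ε : F, PresentedBy N (commPair 1 ε) := by
        have h' := h.commPair_change 0 (inv_ne_zero ha)
        rw [mul_inv_cancel₀ ha, mul_zero, zero_add] at h'
        exact ⟨_, h'⟩
      obtain ⟨s, ⟨hs, l, hl⟩, -⟩ := (hB hchar).2 ε trivial
      refine ⟨.U1_1 s, ⟨hchar, hs⟩, PresentedBy.algIso (S := commPair 1 s) ?_ (presentedBy_U1_1 s)⟩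
      convert hε.commPair_change l one_ne_zero using 2
      · linear_combination -l * h2
      · linear_combination -hl
  · have h2 : (2 : F) ≠ 0 := Ring.two_ne_zero hchar
    obtain ⟨σ, hσ⟩ : ∃ σ : F, PresentedBy N (commPair 0 σ) := by
      -- Completing the square removes the coefficient `a`.
      have h' := h.commPair_change (-a / 2) one_ne_zero
      rw [mul_div_cancel₀ _ h2, mul_one, neg_add_cancel] at h'
      exact ⟨_, h'⟩
    by_cases h0 : σ = 0
    · subst h0
      exact ⟨.U1_00, hchar, hσ.algIso presentedBy_U1_00⟩
    · obtain ⟨s, hs, hsN⟩ := toQ σ h0 hσ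
      exact ⟨.U1_0 s, Or.inl ⟨hchar, hs⟩, hsN.algIso (presentedBy_U1_0 s)⟩

lemma exists_noncommRow_of_pair (hQ : IsSquareTransversal Q) (hB : ringChar F = 2 → IsBSet B)
    (hA : ∀ ρ ∈ Q, IsASet ρ (A ρ)) {S T : Matrix (Fin 2) (Fin 2) F} (h : PresentedBy N ![S, T])
    (hi : FormsIndep ![S, T]) (hns : S 0 1 ≠ S 1 0 ∨ T 0 1 ≠ T 1 0) :
    ∃ r : NoncommRow F, r.Listed Q B A PA ∧ AlgIso F N r.algebra := by
  rw [Matrix.eta_fin_two S, Matrix.eta_fin_two T] at h hi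
  obtain ⟨p, q, r, t₁, t₂, t₃, t₄, h, ht, hpqr⟩ := exists_symm_asymm h hi hns
  obtain ⟨ρ, b, c, d, h, hbc⟩ | ⟨h2, a, d, h⟩ := exists_diagPair_or_hypPair h ht hpqr
  · by_cases hρ : ρ = 0
    · subst hρ
      obtain h | h | ⟨l, hl, h⟩ := exists_U3 h hbc
      · exact ⟨.U3_010, trivial, h.algIso presentedBy_U3_010⟩
      · exact ⟨.U3_011, trivial, h.algIso presentedBy_U3_011⟩
      · exact ⟨.U3_1 l, hl, h.algIso (presentedBy_U3_1 l)⟩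
    · obtain ⟨β₁, β₂, hβ, h⟩ := exists_U4 h hbc hρ
      obtain ⟨s, ⟨hs, hρs⟩, -⟩ := hQ.2 ρ hρ
      obtain ⟨β₂', h⟩ := h.diagPair_of_sqClass hρs
      obtain ⟨⟨γ₁, γ₂⟩, ⟨hγ, hrel⟩, -⟩ := (hA s hs).2 (β₁, β₂') hβ
      exact ⟨.U4 s γ₁ γ₂, ⟨hs, hγ⟩, (h.diagPair_of_aRel hrel).algIso (presentedBy_U4 s γ₁ γ₂)⟩
  · have hchar : ringChar F = 2 := by
      by_contra hc
      exact Ring.two_ne_zero hc h2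
    obtain ⟨ε, h⟩ := exists_U5 h2 h
    obtain ⟨s, ⟨hs, hεs⟩, -⟩ := (hB hchar).2 ε trivial
    exact ⟨.U5_11 s, ⟨hchar, hs⟩,
      (h.hypPair_of_artinSchreierClass h2 hεs).algIso (presentedBy_U5_11 s)⟩

lemma transpose_pair_iff {R : Type*} {S T : Matrix (Fin 2) (Fin 2) R} :
    (∀ k, (![S, T] k).transpose = ![S, T] k) ↔ S 0 1 = S 1 0 ∧ T 0 1 = T 1 0 := by
  simp [Fin.forall_fin_two, ← Matrix.ext_iff, eq_comm]

variable [IsScalarTower F N N] [SMulCommClass F N N]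

lemma exists_commRow (hQ : IsSquareTransversal Q) (hB : ringChar F = 2 → IsBSet B)
    (hC : ringChar F = 2 → IsCSet Q C) (hPS : IsPiS PS) (h4 : Module.finrank F N = 4)
    (hN : IsNilpotentAlgebra F N) (hc : ∀ x y : N, x * y = y * x) :
    ∃ r : CommRow F, r.Listed Q B C PS ∧ AlgIso F N r.algebra := by
  obtain ⟨r, hr, h⟩ | ⟨r, hr, h⟩ | ⟨D, hD⟩ | ⟨S, T, h, hi⟩ := structure_of_finrank_four h4 hN
  · refine ⟨r, ?_, h⟩
    obtain rfl | rfl | rfl := hr <;> trivial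
  · have := h.symm.comm hc
    obtain rfl | rfl := hr
    · exact absurd this NoncommRow.not_comm_U2_01011
    · exact absurd this NoncommRow.not_comm_U2_01001
  · obtain ⟨E, ⟨hE, hDE⟩, -⟩ := hPS.2 D (hD.comm_iff.1 hc 0)
    exact ⟨.RD E, hE, (hD.of_formsSim (formsSim_of_projCongruent hDE)).algIso
      (presentedBy_commRow_RD E)⟩
  · obtain ⟨hS, hT⟩ := transpose_pair_iff.1 (h.comm_iff.1 hc)
    rw [Matrix.eta_fin_two S, Matrix.eta_fin_two T, ← hS, ← hT] at h hi
    obtain ⟨a, ρ, h⟩ := exists_commPair h hi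
    exact exists_commRow_of_commPair hQ hB hC h

lemma exists_noncommRow (hQ : IsSquareTransversal Q) (hB : ringChar F = 2 → IsBSet B)
    (hA : ∀ ρ ∈ Q, IsASet ρ (A ρ)) (hPA : IsPiA PA) (h4 : Module.finrank F N = 4)
    (hN : IsNilpotentAlgebra F N) (hc : ¬ ∀ x y : N, x * y = y * x) :
    ∃ r : NoncommRow F, r.Listed Q B A PA ∧ AlgIso F N r.algebra := by
  obtain ⟨r, hr, h⟩ | ⟨r, hr, h⟩ | ⟨D, hD⟩ | ⟨S, T, h, hi⟩ := structure_of_finrank_four h4 hN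
  · refine absurd (h.comm ?_) hc
    obtain rfl | rfl | rfl := hr
    · exact CommRow.mul_comm_S5
    · exact CommRow.mul_comm_S41
    · exact CommRow.mul_comm_S32sharp
  · refine ⟨r, ?_, h⟩
    obtain rfl | rfl := hr <;> trivial
  · obtain ⟨E, ⟨hE, hDE⟩, -⟩ := hPA.2 D fun hs => hc (hD.comm_iff.2 fun _ => hs)
    exact ⟨.RD E, hE, (hD.of_formsSim (formsSim_of_projCongruent hDE)).algIso
      (presentedBy_noncommRow_RD E)⟩
  · rw [h.comm_iff, transpose_pair_iff, not_and_or] at hc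
    exact exists_noncommRow_of_pair hQ hB hA h hi hc

end Lists

/-! ### Commutativity of the rows, and no isomorphisms between different rows. -/

section Rows

variable {F : Type*} [Field F]
  {Q B C : Set F} {A : F → Set (F × F)} {PS PA : Set (Matrix (Fin 3) (Fin 3) F)}

lemma CommRow.Listed.mul_comm (hPS : IsPiS PS) {r : CommRow F} (hr : r.Listed Q B C PS)
    (x y : r.algebra) : x * y = y * x := by
  cases r with
  | S5 => exact mul_comm_S5 x y
  | S41 => exact mul_comm_S41 x y
  | S32sharp => exact mul_comm_S32sharp x y
  | U1_00 => exact presentedBy_U1_00.comm_iff.2 (transpose_pair_iff.2 (by simp)) x y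
  | U1_0 ρ => exact (presentedBy_U1_0 ρ).comm_iff.2 (transpose_pair_iff.2 (by simp)) x y
  | U1_1 ε => exact (presentedBy_U1_1 ε).comm_iff.2 (transpose_pair_iff.2 (by simp)) x y
  | RD D => exact (presentedBy_commRow_RD D).comm_iff.2 (fun _ => hPS.1 hr) x y

lemma NoncommRow.Listed.not_mul_comm (hA : ∀ ρ ∈ Q, IsASet ρ (A ρ)) (hPA : IsPiA PA)
    {r : NoncommRow F} (hr : r.Listed Q B A PA) : ¬ ∀ x y : r.algebra, x * y = y * x := by
  cases r with
  | U2_01011 => exact not_comm_U2_01011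
  | U2_01001 => exact not_comm_U2_01001
  | U3_010 =>
    rw [presentedBy_U3_010.comm_iff, transpose_pair_iff]
    simp
  | U3_011 =>
    rw [presentedBy_U3_011.comm_iff, transpose_pair_iff]
    simp
  | U3_1 l =>
    rw [(presentedBy_U3_1 l).comm_iff, transpose_pair_iff]
    simpa using Ne.symm hr
  | U4 ρ β₁ β₂ =>
    rw [(presentedBy_U4 ρ β₁ β₂).comm_iff, transpose_pair_iff]
    have : β₁ ≠ 1 := (hA ρ hr.1).1 hr.2
    simpa using this.symm
  | U5_11 ε =>
    rw [(presentedBy_U5_11 ε).comm_iff, transpose_pair_iff]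
    simp
  | RD D =>
    rw [(presentedBy_noncommRow_RD D).comm_iff]
    exact fun h => hPA.1 hr (h 0)

lemma commRow_eq_of_algIso (hQ : IsSquareTransversal Q) (hB : ringChar F = 2 → IsBSet B)
    (hC : ringChar F = 2 → IsCSet Q C) (hPS : IsPiS PS) {r s : CommRow F}
    (hr : r.Listed Q B C PS) (hs : s.Listed Q B C PS) (h : AlgIso F r.algebra s.algebra) :
    r = s := by
  by_cases hc : r.Cubic
  · exact hc.eq_of_algIso (hc.of_algIso h) h
  have hc' : ¬ s.Cubic := fun hs => hc (hs.of_algIso h.symm)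
  have sqRefl : ∀ a : F, SqClass F a a := fun a => ⟨1, one_ne_zero, by simp⟩
  have notZero : ∀ {a ρ : F}, PresentedBy r.algebra (commPair 0 a) →
      PresentedBy r.algebra (commPair 0 ρ) → (ringChar F ≠ 2) → a = 0 → ρ ∈ Q → False := by
    rintro a ρ h₁ h₂ hchar rfl hρ
    obtain ⟨c, hc, h0⟩ := sqClass_of_commPair (Ring.two_ne_zero hchar) h₂ h₁
    exact hQ.1 hρ (by simpa using h0)
  cases r with
  | S5 => exact absurd (Or.inl rfl) hc
  | S41 => exact absurd (Or.inr (Or.inl rfl)) hc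
  | S32sharp => exact absurd (Or.inr (Or.inr rfl)) hc
  | U1_00 =>
    have hr' : PresentedBy (CommRow.U1_00 (F := F)).algebra (commPair (0 : F) 0) :=
      presentedBy_U1_00
    cases s with
    | S5 => exact absurd (Or.inl rfl) hc'
    | S41 => exact absurd (Or.inr (Or.inl rfl)) hc'
    | S32sharp => exact absurd (Or.inr (Or.inr rfl)) hc'
    | U1_00 => rfl
    | U1_0 ρ =>
      have hs' := PresentedBy.of_algIso (S := commPair 0 ρ) (presentedBy_U1_0 ρ) h
      obtain ⟨hchar, hρ⟩ | ⟨hchar, -⟩ := hs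
      · exact (notZero hr' hs' hchar rfl hρ).elim
      · exact absurd hchar hr
    | U1_1 ε => exact absurd hs.1 hr
    | RD D =>
      exact (not_presentedBy_pair_and_single (formsIndep_commPair _ _) hr'
        ((presentedBy_commRow_RD D).of_algIso h)).elim
  | U1_0 ρ =>
    have hr' : PresentedBy (CommRow.U1_0 ρ).algebra (commPair 0 ρ) := presentedBy_U1_0 ρ
    cases s with
    | S5 => exact absurd (Or.inl rfl) hc'
    | S41 => exact absurd (Or.inr (Or.inl rfl)) hc'
    | S32sharp => exact absurd (Or.inr (Or.inr rfl)) hc'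
    | U1_00 =>
      have hs' := PresentedBy.of_algIso (S := commPair (0 : F) 0) presentedBy_U1_00 h
      obtain ⟨hchar, hρ⟩ | ⟨hchar, -⟩ := hr
      · exact (notZero hs' hr' hchar rfl hρ).elim
      · exact absurd hchar hs
    | U1_0 σ =>
      have hs' := PresentedBy.of_algIso (S := commPair 0 σ) (presentedBy_U1_0 σ) h
      obtain ⟨hchar, hρ⟩ | ⟨hchar, hρ⟩ := hr
      · obtain ⟨-, hσ⟩ | ⟨hchar', -⟩ := hs
        · rw [hQ.eq hρ hσ (sqRefl ρ) (sqClass_of_commPair (Ring.two_ne_zero hchar) hr' hs')]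
        · exact absurd hchar' hchar
      · obtain ⟨hchar', -⟩ | ⟨-, hσ⟩ := hs
        · exact absurd hchar hchar'
        · have h2 := two_eq_zero_of_ringChar hchar
          -- The reflexive instance comes from comparing a presentation with itself.
          rw [(hC hchar).eq hρ hσ (starRel_of_commPair h2 hr' hr')
            (starRel_of_commPair h2 hs' hr')]
    | U1_1 ε =>
      exact (not_commPair_zero_one (two_eq_zero_of_ringChar hs.1)
        (PresentedBy.of_algIso (S := commPair 1 ε) (presentedBy_U1_1 ε) h) hr').elim
    | RD D =>
      exact (not_presentedBy_pair_and_single (formsIndep_commPair _ _) hr'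
        ((presentedBy_commRow_RD D).of_algIso h)).elim
  | U1_1 ε =>
    have hr' : PresentedBy (CommRow.U1_1 ε).algebra (commPair 1 ε) := presentedBy_U1_1 ε
    cases s with
    | S5 => exact absurd (Or.inl rfl) hc'
    | S41 => exact absurd (Or.inr (Or.inl rfl)) hc'
    | S32sharp => exact absurd (Or.inr (Or.inr rfl)) hc'
    | U1_00 => exact absurd hr.1 hs
    | U1_0 ρ =>
      exact (not_commPair_zero_one (two_eq_zero_of_ringChar hr.1) hr'
        (PresentedBy.of_algIso (S := commPair 0 ρ) (presentedBy_U1_0 ρ) h)).elim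
    | U1_1 η =>
      have hs' := PresentedBy.of_algIso (S := commPair 1 η) (presentedBy_U1_1 η) h
      have h2 := two_eq_zero_of_ringChar hr.1
      rw [(hB hr.1).eq hr.2 hs.2 (artinSchreierClass_of_commPair h2 hr' hr')
        (artinSchreierClass_of_commPair h2 hs' hr')]
    | RD D =>
      exact (not_presentedBy_pair_and_single (formsIndep_commPair _ _) hr'
        ((presentedBy_commRow_RD D).of_algIso h)).elim
  | RD D =>
    have hr' := presentedBy_commRow_RD D
    cases s with
    | S5 => exact absurd (Or.inl rfl) hc'
    | S41 => exact absurd (Or.inr (Or.inl rfl)) hc'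
    | S32sharp => exact absurd (Or.inr (Or.inr rfl)) hc'
    | U1_00 =>
      exact (not_presentedBy_pair_and_single (formsIndep_commPair 0 0)
        (PresentedBy.of_algIso presentedBy_U1_00 h) hr').elim
    | U1_0 ρ =>
      exact (not_presentedBy_pair_and_single (formsIndep_commPair 0 ρ)
        (PresentedBy.of_algIso (presentedBy_U1_0 ρ) h) hr').elim
    | U1_1 ε =>
      exact (not_presentedBy_pair_and_single (formsIndep_commPair 1 ε)
        (PresentedBy.of_algIso (presentedBy_U1_1 ε) h) hr').elim
    | RD E =>
      rw [hPS.eq hr hs (ProjCongruent.refl D)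
        (projCongruent_of_presentedBy hr' ((presentedBy_commRow_RD E).of_algIso h))]

/-- The presentations of the rows of the noncommutative table other than `RD` with zero cube. -/
inductive NoncommRow.Pair : NoncommRow F → (Fin 2 → Matrix (Fin 2) (Fin 2) F) → Prop
  | U3_010 : Pair .U3_010 (diagPair 0 0 1 0)
  | U3_011 : Pair .U3_011 (diagPair 0 0 1 1)
  | U3_1 (l : F) : Pair (.U3_1 l) (diagPair 0 1 l 0)
  | U4 (ρ β₁ β₂ : F) : Pair (.U4 ρ β₁ β₂) (diagPair ρ 1 β₁ β₂)
  | U5_11 (ε : F) : Pair (.U5_11 ε) (hypPair 1 ε)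

lemma NoncommRow.Pair.presentedBy {r : NoncommRow F} {S : Fin 2 → Matrix (Fin 2) (Fin 2) F}
    (h : r.Pair S) : PresentedBy r.algebra S := by
  cases h with
  | U3_010 => exact presentedBy_U3_010
  | U3_011 => exact presentedBy_U3_011
  | U3_1 l => exact presentedBy_U3_1 l
  | U4 ρ β₁ β₂ => exact presentedBy_U4 ρ β₁ β₂
  | U5_11 ε => exact presentedBy_U5_11 ε

lemma NoncommRow.Pair.formsIndep (hA : ∀ ρ ∈ Q, IsASet ρ (A ρ)) {r : NoncommRow F}
    (hr : r.Listed Q B A PA) {S : Fin 2 → Matrix (Fin 2) (Fin 2) F} (h : r.Pair S) :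
    FormsIndep S := by
  cases h with
  | U3_010 => exact formsIndep_diagPair zero_ne_one
  | U3_011 => exact formsIndep_diagPair zero_ne_one
  | U3_1 l => exact formsIndep_diagPair (Ne.symm hr)
  | U4 ρ β₁ β₂ => exact formsIndep_diagPair (Ne.symm ((hA ρ hr.1).1 hr.2))
  | U5_11 ε => exact formsIndep_hypPair 1 ε

lemma NoncommRow.cubic_or_pair_or_RD (r : NoncommRow F) :
    r.Cubic ∨ (∃ S, r.Pair S) ∨ ∃ D, r = .RD D := by
  cases r with
  | U2_01011 => exact Or.inl (Or.inl rfl)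
  | U2_01001 => exact Or.inl (Or.inr rfl)
  | U3_010 => exact Or.inr (Or.inl ⟨_, .U3_010⟩)
  | U3_011 => exact Or.inr (Or.inl ⟨_, .U3_011⟩)
  | U3_1 l => exact Or.inr (Or.inl ⟨_, .U3_1 l⟩)
  | U4 ρ β₁ β₂ => exact Or.inr (Or.inl ⟨_, .U4 ρ β₁ β₂⟩)
  | U5_11 ε => exact Or.inr (Or.inl ⟨_, .U5_11 ε⟩)
  | RD D => exact Or.inr (Or.inr ⟨D, rfl⟩)

/-- The symmetric member of the pencil separates the families: degenerate for `U3`, alternating for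
`U5`, nondegenerate and not alternating for `U4`. Inside `U3` the second form on the radical of the
symmetric member distinguishes the rows, followed by the ratio of its off-diagonal entries. -/
lemma noncommRow_eq_of_pair {N : Type*} [NonUnitalRing N] [Module F N]
    (hQ : IsSquareTransversal Q) (hB : ringChar F = 2 → IsBSet B)
    (hA : ∀ ρ ∈ Q, IsASet ρ (A ρ)) {r s : NoncommRow F}
    (hr : r.Listed Q B A PA) (hs : s.Listed Q B A PA) {S T : Fin 2 → Matrix (Fin 2) (Fin 2) F}
    (hrS : r.Pair S) (hsT : s.Pair T) (hS : PresentedBy N S) (hT : PresentedBy N T) : r = s := by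
  have not_U3_U4 : ∀ {ρ β₁ β₂ b c d : F}, NoncommRow.Listed Q B A PA (.U4 ρ β₁ β₂) →
      PresentedBy N (diagPair ρ 1 β₁ β₂) → PresentedBy N (diagPair 0 b c d) → b ≠ c → False := by
    intro ρ β₁ β₂ b c d hL h h' hbc
    obtain ⟨k, hk, h0⟩ := sqClass_of_diagPair hbc h' h
    exact hQ.1 hL.1 (by simpa using h0)
  have not_U5 : ∀ {ε ρ b c d : F}, NoncommRow.Listed Q B A PA (.U5_11 ε) →
      PresentedBy N (hypPair 1 ε) → PresentedBy N (diagPair ρ b c d) → b ≠ c → False :=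
    fun hL h h' hbc => not_hypPair_diagPair (two_eq_zero_of_ringChar hL.1) hbc h' h
  have hβ : ∀ {ρ β₁ β₂ : F}, NoncommRow.Listed Q B A PA (.U4 ρ β₁ β₂) → β₁ ≠ 1 :=
    fun hL => (hA _ hL.1).1 hL.2
  have not_of_d : ∀ {b c b' c' d' : F}, b ≠ c → PresentedBy N (diagPair 0 b c 0) →
      PresentedBy N (diagPair 0 b' c' d') → d' ≠ 0 → False := by
    intro b c b' c' d' hbc h h' hd
    obtain ⟨x, y, w, n, -, hw, -, -, -, h0⟩ := U3_relation hbc h h'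
    simp [hd, hw] at h0
  have not_of_b : ∀ {l : F}, l ≠ 1 → PresentedBy N (diagPair 0 1 l 0) →
      PresentedBy N (diagPair (0 : F) 0 1 0) → False := by
    intro l hl h h'
    obtain ⟨x, y, w, n, -, -, hn, h0, -, -⟩ := U3_relation hl.symm h h'
    exact hn (by simpa using h0.symm)
  cases hrS with
  | U3_010 =>
    cases hsT with
    | U3_010 => rfl
    | U3_011 => exact (not_of_d zero_ne_one hS hT one_ne_zero).elim
    | U3_1 l => exact (not_of_b hs hT hS).elim
    | U4 ρ β₁ β₂ => exact (not_U3_U4 hs hT hS zero_ne_one).elim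
    | U5_11 ε => exact (not_U5 hs hT hS zero_ne_one).elim
  | U3_011 =>
    cases hsT with
    | U3_010 => exact (not_of_d zero_ne_one hT hS one_ne_zero).elim
    | U3_011 => rfl
    | U3_1 l => exact (not_of_d (Ne.symm hs) hT hS one_ne_zero).elim
    | U4 ρ β₁ β₂ => exact (not_U3_U4 hs hT hS zero_ne_one).elim
    | U5_11 ε => exact (not_U5 hs hT hS zero_ne_one).elim
  | U3_1 l =>
    cases hsT with
    | U3_010 => exact (not_of_b hr hS hT).elim
    | U3_011 => exact (not_of_d (Ne.symm hr) hS hT one_ne_zero).elim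
    | U3_1 l' =>
      obtain ⟨x, y, w, n, hx, hw, -, h1, h2, -⟩ := U3_relation (Ne.symm hr) hS hT
      have : l' = l := by
        apply mul_left_cancel₀ (mul_ne_zero hw hx)
        linear_combination h2 - l * h1
      rw [this]
    | U4 ρ β₁ β₂ => exact (not_U3_U4 hs hT hS (Ne.symm hr)).elim
    | U5_11 ε => exact (not_U5 hs hT hS (Ne.symm hr)).elim
  | U4 ρ β₁ β₂ =>
    cases hsT with
    | U3_010 => exact (not_U3_U4 hr hS hT zero_ne_one).elim
    | U3_011 => exact (not_U3_U4 hr hS hT zero_ne_one).elim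
    | U3_1 l => exact (not_U3_U4 hr hS hT (Ne.symm hs)).elim
    | U4 σ γ₁ γ₂ =>
      obtain rfl : ρ = σ := hQ.eq hr.1 hs.1 ⟨1, one_ne_zero, by simp⟩
        (sqClass_of_diagPair (hβ hs).symm hT hS)
      have hρ : ρ ≠ 0 := hQ.1 hr.1
      have := (hA ρ hr.1).eq hr.2 hs.2 (aRel_of_diagPair hρ (hβ hr) hS hS)
        (aRel_of_diagPair hρ (hβ hs) hT hS)
      obtain ⟨rfl, rfl⟩ := Prod.mk.inj this
      rfl
    | U5_11 ε => exact (not_U5 hs hT hS (hβ hr).symm).elim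
  | U5_11 ε =>
    cases hsT with
    | U3_010 => exact (not_U5 hr hS hT zero_ne_one).elim
    | U3_011 => exact (not_U5 hr hS hT zero_ne_one).elim
    | U3_1 l => exact (not_U5 hr hS hT (Ne.symm hs)).elim
    | U4 ρ β₁ β₂ => exact (not_U5 hr hS hT (hβ hs).symm).elim
    | U5_11 η =>
      have h2 := two_eq_zero_of_ringChar hr.1
      rw [(hB hr.1).eq hr.2 hs.2 (artinSchreierClass_of_hypPair h2 hS hS)
        (artinSchreierClass_of_hypPair h2 hS hT)]

lemma noncommRow_eq_of_algIso (hQ : IsSquareTransversal Q) (hB : ringChar F = 2 → IsBSet B)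
    (hA : ∀ ρ ∈ Q, IsASet ρ (A ρ)) (hPA : IsPiA PA) {r s : NoncommRow F}
    (hr : r.Listed Q B A PA) (hs : s.Listed Q B A PA) (h : AlgIso F r.algebra s.algebra) :
    r = s := by
  by_cases hc : r.Cubic
  · exact hc.eq_of_algIso (hc.of_algIso h) h
  have hc' : ¬ s.Cubic := fun hs => hc (hs.of_algIso h.symm)
  obtain ⟨S, hS⟩ | ⟨D, rfl⟩ := r.cubic_or_pair_or_RD.resolve_left hc <;>
    obtain ⟨T, hT⟩ | ⟨E, rfl⟩ := s.cubic_or_pair_or_RD.resolve_left hc'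
  · exact noncommRow_eq_of_pair hQ hB hA hr hs hS hT hS.presentedBy (hT.presentedBy.of_algIso h)
  · exact (not_presentedBy_pair_and_single (hS.formsIndep hA hr) hS.presentedBy
      ((presentedBy_noncommRow_RD E).of_algIso h)).elim
  · exact (not_presentedBy_pair_and_single (hT.formsIndep hA hs) (hT.presentedBy.of_algIso h)
      (presentedBy_noncommRow_RD D)).elim
  · rw [hPA.eq hr hs (ProjCongruent.refl D) (projCongruent_of_presentedBy
      (presentedBy_noncommRow_RD D) ((presentedBy_noncommRow_RD E).of_algIso h))]

end Rows

end NilpAlg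

theorem theorem1p1 {F : Type*} [Field F]
    (Q B C : Set F) (A : F → Set (F × F)) (PS PA : Set (Matrix (Fin 3) (Fin 3) F))
    (hQ : NilpAlg.IsSquareTransversal Q)
    (hB : ringChar F = 2 → NilpAlg.IsBSet B)
    (hC : ringChar F = 2 → NilpAlg.IsCSet Q C)
    (hA : ∀ ρ ∈ Q, NilpAlg.IsASet ρ (A ρ))
    (hPS : NilpAlg.IsPiS PS) (hPA : NilpAlg.IsPiA PA) :
    -- the listed algebras are 4-dimensional nilpotent algebras, commutative in the first table
    -- and noncommutative in the second one
    (∀ r : NilpAlg.CommRow F, r.Listed Q B C PS →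
      Module.finrank F r.algebra = 4 ∧ NilpAlg.IsNilpotentAlgebra F r.algebra ∧
        ∀ x y : r.algebra, x * y = y * x) ∧
    (∀ r : NilpAlg.NoncommRow F, r.Listed Q B A PA →
      Module.finrank F r.algebra = 4 ∧ NilpAlg.IsNilpotentAlgebra F r.algebra ∧
        ¬ ∀ x y : r.algebra, x * y = y * x) ∧
    -- every 4-dimensional nilpotent algebra is isomorphic to a listed one
    (∀ (N : Type*) [NonUnitalRing N] [Module F N] [IsScalarTower F N N] [SMulCommClass F N N],
      Module.finrank F N = 4 → NilpAlg.IsNilpotentAlgebra F N →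
        ((∀ x y : N, x * y = y * x) →
          ∃ r : NilpAlg.CommRow F, r.Listed Q B C PS ∧ NilpAlg.AlgIso F N r.algebra) ∧
        ((¬ ∀ x y : N, x * y = y * x) →
          ∃ r : NilpAlg.NoncommRow F, r.Listed Q B A PA ∧ NilpAlg.AlgIso F N r.algebra)) ∧
    -- different listed algebras are not isomorphic
    (∀ r s : NilpAlg.CommRow F, r.Listed Q B C PS → s.Listed Q B C PS →
      NilpAlg.AlgIso F r.algebra s.algebra → r = s) ∧
    (∀ r s : NilpAlg.NoncommRow F, r.Listed Q B A PA → s.Listed Q B A PA →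
      NilpAlg.AlgIso F r.algebra s.algebra → r = s) := by
  refine ⟨fun r hr => ⟨r.finrank_algebra, r.isNilpotentAlgebra, hr.mul_comm hPS⟩,
    fun r hr => ⟨r.finrank_algebra, r.isNilpotentAlgebra, hr.not_mul_comm hA hPA⟩,
    fun N _ _ _ _ h4 hN => ⟨NilpAlg.exists_commRow hQ hB hC hPS h4 hN,
      NilpAlg.exists_noncommRow hQ hB hA hPA h4 hN⟩,
    fun r s hr hs => NilpAlg.commRow_eq_of_algIso hQ hB hC hPS hr hs,
    fun r s hr hs => NilpAlg.noncommRow_eq_of_algIso hQ hB hA hPA hr hs⟩
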